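/- Let $\mathbb K\in\{\mathbb R,\mathbb C\}$, let $X,U$ be Banach spaces over $\mathbb K$, and let $(T(t))_{t\ge0}$ be a $C_0$-semigroup on $X$ with generator $A$. Let $\beta_0\in\rho(A)$, let $X_{-1}$ be the completion of $X$ with respect to the norm $\|x\|_{X_{-1}}=\|(\beta_0-A)^{-1}x\|_X$, let $(T_{-1}(t))_{t\ge0}$ be the extension of $(T(t))_{t\ge 0}$ to $X_{-1}$, and let $B\colon U\to X_{-1}$ be linear and bounded. For $x_0\in X$, $t\ge 0$ and $u\in L^1(0,t;U)$ put $$x(t)=T(t)x_0+\int_0^tT_{-1}(t-s)Bu(s)\,ds\in X_{-1}.$$ Function classes on $[0,\infty)$: $\mathcal K$ is the set of continuous, strictly increasing $\mu\colon[0,\infty)\to[0,\infty)$ with $\mu(0)=0$; $\mathcal K_\infty$ is the set of $\theta\in\mathcal K$ with $\lim_{s\to\infty}\theta(s)=\infty$; $\mathcal{KL}$ is the set of $\beta\colon[0,\infty)^2\to[0,\infty)$ such that $\beta(\cdot,t)\in\mathcal K$ for all $t\ge0$ and, for all $s>0$, $\beta(s,\cdot)$ is continuous, strictly decreasing and tends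 to $0$ at $\infty$. A Young function is a function of the form $\Phi(t)=\int_0^t\varphi(s)\,ds$, $t\ge0$, where $\varphi\colon[0,\infty)\to\mathbb R$ is right-continuous and nondecreasing, $\varphi(0)=0$, $\varphi(s)>0$ for $s>0$, and $\lim_{s\to\infty}\varphi(s)=\infty$. For a Young function $\Phi$, $L_\Phi(0,t;U)$ is the space of (classes of) Bochner-measurable $u\colon(0,t)\to U$ with $\int_0^t\Phi(k^{-1}\|u(s)\|)\,ds<\infty$ for some $k>0$, with the Luxemburg norm $\|u\|_\Phi=\inf\{k>0:\int_0^t\Phi(k^{-1}\|u(s)\|)\,ds\le1\}$, and $E_\Phi(0,t;U)$ is the closure of $L^\infty(0,t;U)$ in $L_\Phi(0,t;U)$, with the same norm. Let $Z(0,t;U)$ stand for $L^\infty(0,t;U)$ ($Z=L^\infty$) or $E_\Phi(0,t;U)$ ($Z=E_\Phi$). The system $\Sigma(A,B)$ is called * $Z$-ISS if there are $\beta\in\mathcal{KL}$ and $\mu\in\mathcal K_\infty$ such that for all $t\ge0$, $x_0\in X$, $u\in Z(0,t;U)$: $x(t)\in X$ and $\|x(t)\|\le\beta(\|x_0\|,t)+\mu(\|u\|_{Z(0,t;U)})$;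 * $Z$-iISS if there are $\beta\in\mathcal{KL}$, $\theta\in\mathcal K_\infty$ and $\mu\in\mathcal K$ such that for all $t\ge0$, $x_0\in X$, $u\in Z(0,t;U)$: $x(t)\in X$ and $\|x(t)\|\le\beta(\|x_0\|,t)+\theta\left(\int_0^t\mu(\|u(s)\|)\,ds\right)$; * $Z$-UBEBS if there are $\gamma,\theta\in\mathcal K_\infty$, $\mu\in\mathcal K$ and $c>0$ such that for all $t\ge0$, $x_0\in X$, $u\in Z(0,t;U)$: $x(t)\in X$ and $\|x(t)\|\le\gamma(\|x_0\|)+\theta\left(\int_0^t\mu(\|u(s)\|)\,ds\right)+c$. (If the integral is infinite, the inequality is understood to hold.) The semigroup is exponentially stable if there are $M,\omega>0$ with $\|T(t)\|\le Me^{-\omega t}$ for all $t\ge0$. **Theorem.** The following statements are equivalent. (i) There is a Young function $\Phi$ such that $\Sigma(A,B)$ is $E_\Phi$-ISS. (ii) $\Sigma(A,B)$ is $L^\infty$-iISS. (iii) $(T(t))_{t\ge0}$ is exponentially stable and there is a Young function $\Phi$ such that $\Sigma(A,B)$ is $E_\Phi$-UBEBS. -/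

import Mathlib

open MeasureTheory Filter Topology Set
open scoped NNReal ENNReal

noncomputable section

/-! ### Strongly continuous semigroups, generators, resolvents -/

/-- A `C₀`-semigroup `(T(t))_{t ≥ 0}` of bounded linear operators on `X`. -/
structure C0Semigroup (𝕜 X : Type*) [RCLike 𝕜] [NormedAddCommGroup X] [NormedSpace 𝕜 X] where
  toFun : ℝ≥0 → X →L[𝕜] X
  map_zero : toFun 0 = ContinuousLinearMap.id 𝕜 X
  map_add : ∀ s t : ℝ≥0, toFun (s + t) = (toFun s).comp (toFun t)
  tendsto_zero : ∀ x : X, Tendsto (fun t : ℝ≥0 => toFun t x) (𝓝[>] 0) (𝓝 x)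

namespace C0Semigroup

variable {𝕜 X : Type*} [RCLike 𝕜] [NormedAddCommGroup X] [NormedSpace 𝕜 X]

instance : CoeFun (C0Semigroup 𝕜 X) (fun _ => ℝ≥0 → X →L[𝕜] X) := ⟨C0Semigroup.toFun⟩

/-- The difference quotient `h⁻¹ (T(h) x - x)`. -/
def diffQuot (T : C0Semigroup 𝕜 X) (x : X) (h : ℝ≥0) : X :=
  (((h : ℝ) : 𝕜))⁻¹ • (T h x - x)

theorem diffQuot_add (T : C0Semigroup 𝕜 X) (x y : X) (h : ℝ≥0) :
    T.diffQuot (x + y) h = T.diffQuot x h + T.diffQuot y h := by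
  simp only [diffQuot, ← smul_add, _root_.map_add]
  congr 1
  abel

theorem diffQuot_smul (T : C0Semigroup 𝕜 X) (c : 𝕜) (x : X) (h : ℝ≥0) :
    T.diffQuot (c • x) h = c • T.diffQuot x h := by
  simp only [diffQuot, map_smul, ← smul_sub]
  rw [smul_comm]

/-- The infinitesimal generator `A` of the semigroup: its domain consists of all `x` for which
`lim_{h ↓ 0} h⁻¹ (T(h) x - x)` exists, and `A x` is this limit. -/
def generator (T : C0Semigroup 𝕜 X) : X →ₗ.[𝕜] X where
  domain :=
    { carrier := {x | ∃ y, Tendsto (T.diffQuot x) (𝓝[>] 0) (𝓝 y)}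
      add_mem' := by
        rintro x y ⟨x', hx⟩ ⟨y', hy⟩
        exact ⟨x' + y', (hx.add hy).congr fun h => (T.diffQuot_add x y h).symm⟩
      zero_mem' := ⟨0, tendsto_const_nhds.congr fun h => by simp [diffQuot]⟩
      smul_mem' := by
        rintro c x ⟨x', hx⟩
        exact ⟨c • x', (hx.const_smul c).congr fun h => (T.diffQuot_smul c x h).symm⟩ }
  toFun :=
    { toFun := fun x => x.2.choose
      map_add' := fun x y => tendsto_nhds_unique (x + y).2.choose_spec
        ((x.2.choose_spec.add y.2.choose_spec).congr fun h => (T.diffQuot_add x y h).symm)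
      map_smul' := fun c x => tendsto_nhds_unique (c • x).2.choose_spec
        ((x.2.choose_spec.const_smul c).congr fun h => (T.diffQuot_smul c x h).symm) }

theorem tendsto_generator (T : C0Semigroup 𝕜 X) (x : T.generator.domain) :
    Tendsto (T.diffQuot (x : X)) (𝓝[>] 0) (𝓝 (T.generator x)) :=
  x.2.choose_spec

theorem generator_eq (T : C0Semigroup 𝕜 X) (x : T.generator.domain) {y : X}
    (h : Tendsto (T.diffQuot (x : X)) (𝓝[>] 0) (𝓝 y)) : T.generator x = y :=
  tendsto_nhds_unique (T.tendsto_generator x) h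

end C0Semigroup

/-- `R` is the bounded inverse `(β - A)⁻¹` of `β - A : D(A) → X`. -/
structure IsResolventAt {𝕜 X : Type*} [RCLike 𝕜] [NormedAddCommGroup X] [NormedSpace 𝕜 X]
    (A : X →ₗ.[𝕜] X) (β : 𝕜) (R : X →L[𝕜] X) : Prop where
  mem_domain : ∀ x, R x ∈ A.domain
  right_inv : ∀ x, β • R x - A ⟨R x, mem_domain x⟩ = x
  left_inv : ∀ x : A.domain, R (β • (x : X) - A x) = x

namespace C0Semigroup

variable {𝕜 X : Type*} [RCLike 𝕜] [NormedAddCommGroup X] [NormedSpace 𝕜 X]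

/-- The resolvent set `ρ(A)` of the generator `A` of the semigroup. -/
def resolventSet (T : C0Semigroup 𝕜 X) : Set 𝕜 :=
  {β | ∃ R : X →L[𝕜] X, IsResolventAt T.generator β R}

/-- The resolvent `(β - A)⁻¹` for `β ∈ ρ(A)`. -/
def resolvent (T : C0Semigroup 𝕜 X) (β : T.resolventSet) : X →L[𝕜] X :=
  β.2.choose

theorem resolvent_spec (T : C0Semigroup 𝕜 X) (β : T.resolventSet) :
    IsResolventAt T.generator (β : 𝕜) (T.resolvent β) :=
  β.2.choose_spec

theorem resolvent_injective (T : C0Semigroup 𝕜 X) (β : T.resolventSet) :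
    Function.Injective (T.resolvent β) := by
  intro x y hxy
  have hR := T.resolvent_spec β
  rw [← hR.right_inv x, ← hR.right_inv y]
  congr! 3

/-- `T(t)` maps the domain of `A` to itself, and `A T(t) x = T(t) A x` there. -/
theorem tendsto_diffQuot_map (T : C0Semigroup 𝕜 X) (t : ℝ≥0) (x : T.generator.domain) :
    Tendsto (T.diffQuot (T t (x : X))) (𝓝[>] 0) (𝓝 (T t (T.generator x))) := by
  refine (((T t).continuous.tendsto _).comp (T.tendsto_generator x)).congr fun h => ?_
  have h1 : T t (T h (x : X)) = T h (T t (x : X)) := by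
    have e1 := congrArg (fun f : X →L[𝕜] X => f (x : X)) (T.map_add t h)
    have e2 := congrArg (fun f : X →L[𝕜] X => f (x : X)) (T.map_add h t)
    rw [add_comm] at e2
    exact e1.symm.trans e2
  simp [diffQuot, h1]

/-- The resolvent commutes with the semigroup. -/
theorem resolvent_comm (T : C0Semigroup 𝕜 X) (β : T.resolventSet) (t : ℝ≥0) (x : X) :
    T.resolvent β (T t x) = T t (T.resolvent β x) := by
  have hR := T.resolvent_spec β
  set z : T.generator.domain := ⟨T.resolvent β x, hR.mem_domain x⟩ with hz
  let w : T.generator.domain := ⟨T t (z : X), _, T.tendsto_diffQuot_map t z⟩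
  have hw : T.generator w = T t (T.generator z) := T.generator_eq w (T.tendsto_diffQuot_map t z)
  have hx : (β : 𝕜) • (z : X) - T.generator z = x := hR.right_inv x
  have h2 := hR.left_inv w
  rw [hw] at h2
  have h3 : (β : 𝕜) • (w : X) - T t (T.generator z) = T t x := by
    conv_rhs => rw [← hx]
    simp [w]
  rw [h3] at h2
  exact h2

/-! ### The extrapolation space `X₋₁` and the extrapolated semigroup `T₋₁` -/

/-- The vector space `X`, to be endowed with the norm `‖x‖₋₁ = ‖(β - A)⁻¹ x‖`. -/
def PreExtrapolation (_T : C0Semigroup 𝕜 X) (_β : _T.resolventSet) : Type _ := X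

instance (T : C0Semigroup 𝕜 X) (β : T.resolventSet) : AddCommGroup (T.PreExtrapolation β) :=
  inferInstanceAs (AddCommGroup X)

instance (T : C0Semigroup 𝕜 X) (β : T.resolventSet) : Module 𝕜 (T.PreExtrapolation β) :=
  inferInstanceAs (Module 𝕜 X)

/-- The identity `X → (X, ‖·‖₋₁)`. -/
def toPre (T : C0Semigroup 𝕜 X) (β : T.resolventSet) : X ≃ₗ[𝕜] T.PreExtrapolation β :=
  LinearEquiv.refl 𝕜 X

/-- `(β - A)⁻¹` as a linear map on `(X, ‖·‖₋₁)`. -/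
def preResolvent (T : C0Semigroup 𝕜 X) (β : T.resolventSet) : T.PreExtrapolation β →ₗ[𝕜] X :=
  (T.resolvent β).toLinearMap ∘ₗ (T.toPre β).symm.toLinearMap

theorem preResolvent_injective (T : C0Semigroup 𝕜 X) (β : T.resolventSet) :
    Function.Injective (T.preResolvent β) :=
  (T.resolvent_injective β).comp (T.toPre β).symm.injective

instance (T : C0Semigroup 𝕜 X) (β : T.resolventSet) :
    NormedAddCommGroup (T.PreExtrapolation β) :=
  NormedAddCommGroup.induced (T.PreExtrapolation β) X (T.preResolvent β)
    (T.preResolvent_injective β)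

theorem norm_toPre (T : C0Semigroup 𝕜 X) (β : T.resolventSet) (x : X) :
    ‖T.toPre β x‖ = ‖T.resolvent β x‖ := rfl

instance (T : C0Semigroup 𝕜 X) (β : T.resolventSet) : NormedSpace 𝕜 (T.PreExtrapolation β) :=
  NormedSpace.induced 𝕜 (T.PreExtrapolation β) X (T.preResolvent β)

/-- The extrapolation space `X₋₁`: the completion of `X` for the norm `‖x‖₋₁ = ‖(β - A)⁻¹ x‖`. -/
def Extrapolation (T : C0Semigroup 𝕜 X) (β : T.resolventSet) : Type _ :=
  UniformSpace.Completion (T.PreExtrapolation β)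

instance (T : C0Semigroup 𝕜 X) (β : T.resolventSet) : NormedAddCommGroup (T.Extrapolation β) :=
  inferInstanceAs (NormedAddCommGroup (UniformSpace.Completion (T.PreExtrapolation β)))

instance (T : C0Semigroup 𝕜 X) (β : T.resolventSet) : NormedSpace 𝕜 (T.Extrapolation β) :=
  inferInstanceAs (NormedSpace 𝕜 (UniformSpace.Completion (T.PreExtrapolation β)))

instance (T : C0Semigroup 𝕜 X) (β : T.resolventSet) : CompleteSpace (T.Extrapolation β) :=
  inferInstanceAs (CompleteSpace (UniformSpace.Completion (T.PreExtrapolation β)))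

/-- The underlying real normed space of `X₋₁` (needed for the Bochner integral). -/
instance (T : C0Semigroup 𝕜 X) (β : T.resolventSet) : NormedSpace ℝ (T.Extrapolation β) :=
  NormedSpace.restrictScalars ℝ 𝕜 (T.Extrapolation β)

instance (T : C0Semigroup 𝕜 X) (β : T.resolventSet) : IsScalarTower ℝ 𝕜 (T.Extrapolation β) where
  smul_assoc r c x := by
    change (r • c) • x = (algebraMap ℝ 𝕜 r) • (c • x)
    rw [Algebra.smul_def, mul_smul]

/-- `T(t)` as a bounded operator on `(X, ‖·‖₋₁)`. -/
def preSemigroup (T : C0Semigroup 𝕜 X) (β : T.resolventSet) (t : ℝ≥0) :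
    T.PreExtrapolation β →L[𝕜] T.PreExtrapolation β :=
  ((T.toPre β).toLinearMap ∘ₗ (T t).toLinearMap ∘ₗ (T.toPre β).symm.toLinearMap).mkContinuous
    ‖T t‖ (fun x => by
      change ‖T.resolvent β (T t x)‖ ≤ ‖T t‖ * ‖T.resolvent β x‖
      exact (congrArg norm (T.resolvent_comm β t ((T.toPre β).symm x))).trans_le
        ((T t).le_opNorm _))

/-- The canonical embedding `X → X₋₁`. -/
def embed (T : C0Semigroup 𝕜 X) (β : T.resolventSet) : X →ₗ[𝕜] T.Extrapolation β :=
  (UniformSpace.Completion.toComplL :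
    T.PreExtrapolation β →L[𝕜] UniformSpace.Completion (T.PreExtrapolation β)).toLinearMap ∘ₗ
      (T.toPre β).toLinearMap

/-- The extrapolated semigroup `T₋₁(t)`: the unique bounded extension of `T(t)` to `X₋₁`. -/
def extrapolated (T : C0Semigroup 𝕜 X) (β : T.resolventSet) (t : ℝ≥0) :
    T.Extrapolation β →L[𝕜] T.Extrapolation β :=
  (T.preSemigroup β t).completion

theorem norm_embed (T : C0Semigroup 𝕜 X) (β : T.resolventSet) (x : X) :
    ‖T.embed β x‖ = ‖T.resolvent β x‖ :=
  UniformSpace.Completion.norm_coe (T.toPre β x)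

theorem extrapolated_embed (T : C0Semigroup 𝕜 X) (β : T.resolventSet) (t : ℝ≥0) (x : X) :
    T.extrapolated β t (T.embed β x) = T.embed β (T t x) :=
  UniformSpace.Completion.map_coe (T.preSemigroup β t).uniformContinuous (T.toPre β x)

/-- `‖T(t)‖ ≤ M e^{-ω t}` for all `t ≥ 0`, with constants `M, ω > 0`. -/
def ExponentiallyStable (T : C0Semigroup 𝕜 X) : Prop :=
  ∃ M ω : ℝ, 0 < M ∧ 0 < ω ∧ ∀ t : ℝ≥0, ‖T t‖ ≤ M * Real.exp (-ω * t)

/-- The mild solution `x(t) = T(t) x₀ + ∫₀ᵗ T₋₁(t - s) B u(s) ds` in `X₋₁` of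
`x' = A x + B u`, `x(0) = x₀`. -/
def mildSolution {U : Type*} [NormedAddCommGroup U] [NormedSpace 𝕜 U]
    (T : C0Semigroup 𝕜 X) (β : T.resolventSet) (B : U →L[𝕜] T.Extrapolation β)
    (x₀ : X) (u : ℝ → U) (t : ℝ≥0) : T.Extrapolation β :=
  T.embed β (T t x₀) +
    ∫ s in Ioo (0 : ℝ) t, T.extrapolated β (Real.toNNReal (t - s)) (B (u s))

end C0Semigroup

/-! ### Comparison functions -/

/-- The class `𝒦`. -/
structure ClassK (μ : ℝ≥0 → ℝ≥0) : Prop where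
  zero : μ 0 = 0
  continuous : Continuous μ
  strictMono : StrictMono μ

/-- The class `𝒦_∞`. -/
structure ClassKInf (θ : ℝ≥0 → ℝ≥0) : Prop extends ClassK θ where
  tendsto : Tendsto θ atTop atTop

/-- The class `ℒ`. -/
structure ClassL (γ : ℝ≥0 → ℝ≥0) : Prop where
  continuous : Continuous γ
  strictAnti : StrictAnti γ
  tendsto : Tendsto γ atTop (𝓝 0)

/-- The class `𝒦ℒ`. -/
structure ClassKL (b : ℝ≥0 → ℝ≥0 → ℝ≥0) : Prop where
  left : ∀ t, ClassK (fun s => b s t)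
  right : ∀ s, 0 < s → ClassL (b s)

/-! ### Young functions and input spaces -/

/-- `Φ(t) = ∫₀ᵗ φ(s) ds` with `φ` right-continuous, nondecreasing, `φ(0) = 0`, `φ > 0` on
`(0, ∞)`, and `φ(s) → ∞` as `s → ∞`. -/
def IsYoungFunction (Φ : ℝ≥0 → ℝ≥0) : Prop :=
  ∃ φ : ℝ≥0 → ℝ≥0,
    (∀ s, ContinuousWithinAt φ (Ici s) s) ∧ Monotone φ ∧ φ 0 = 0 ∧ (∀ s, 0 < s → 0 < φ s) ∧
    Tendsto φ atTop atTop ∧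
    ∀ t : ℝ≥0, (Φ t : ℝ) = ∫ s in Ioo (0 : ℝ) t, (φ (Real.toNNReal s) : ℝ)

/-- Spaces `Z(0,t;U)` of input functions on the interval `(0,t)`, with norm `‖·‖_{Z(0,t;U)}`.
Inputs are represented by functions on `ℝ`, only whose values a.e. on `(0,t)` matter. -/
structure InputSpace (U : Type*) where
  mem : ℝ≥0 → (ℝ → U) → Prop
  norm : ℝ≥0 → (ℝ → U) → ℝ≥0

/-- The measure on the interval `(0,t)`. -/
def intervalMeasure (t : ℝ≥0) : Measure ℝ := volume.restrict (Ioo (0 : ℝ) t)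

section Spaces

variable (U : Type*) [NormedAddCommGroup U]

/-- `L^∞(0,t;U)`. -/
def LInf : InputSpace U where
  mem t u := MemLp u ∞ (intervalMeasure t)
  norm t u := (eLpNorm u ∞ (intervalMeasure t)).toNNReal

variable {U}

/-- The integral `∫₀ᵗ μ(‖u(s)‖) ds ∈ [0,∞]`. -/
def energy (μ : ℝ≥0 → ℝ≥0) (t : ℝ≥0) (u : ℝ → U) : ℝ≥0∞ :=
  ∫⁻ s, (μ ‖u s‖₊ : ℝ≥0∞) ∂(intervalMeasure t)

/-- Membership in the Orlicz space `L_Φ(0,t;U)`: Bochner measurable, and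
`∫₀ᵗ Φ(k⁻¹ ‖u(s)‖) ds < ∞` for some `k > 0`. -/
def MemOrlicz (Φ : ℝ≥0 → ℝ≥0) (t : ℝ≥0) (u : ℝ → U) : Prop :=
  AEStronglyMeasurable u (intervalMeasure t) ∧
    ∃ k : ℝ≥0, 0 < k ∧ energy (fun r => Φ (k⁻¹ * r)) t u < ∞

/-- The Luxemburg norm `inf {k > 0 | ∫₀ᵗ Φ(k⁻¹ ‖u(s)‖) ds ≤ 1}`. -/
def luxemburgNorm (Φ : ℝ≥0 → ℝ≥0) (t : ℝ≥0) (u : ℝ → U) : ℝ≥0 :=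
  sInf {k : ℝ≥0 | 0 < k ∧ energy (fun r => Φ (k⁻¹ * r)) t u ≤ 1}

variable (U)

/-- `E_Φ(0,t;U)`: the closure of `L^∞(0,t;U)` in `L_Φ(0,t;U)` for the Luxemburg norm. -/
def EOrlicz (Φ : ℝ≥0 → ℝ≥0) : InputSpace U where
  mem t u := MemOrlicz Φ t u ∧
    ∀ ε : ℝ≥0, 0 < ε → ∃ v : ℝ → U, MemLp v ∞ (intervalMeasure t) ∧
      luxemburgNorm Φ t (u - v) < ε
  norm t u := luxemburgNorm Φ t u

end Spaces

/-! ### Stability notions for the system `Σ(A,B)` -/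

namespace C0Semigroup

variable {𝕜 X U : Type*} [RCLike 𝕜] [NormedAddCommGroup X] [NormedSpace 𝕜 X]
  [NormedAddCommGroup U] [NormedSpace 𝕜 U]

/-- `Z`-ISS: `x(t) ∈ X` and `‖x(t)‖ ≤ b(‖x₀‖, t) + μ(‖u‖_{Z(0,t;U)})`. -/
def IsISS (T : C0Semigroup 𝕜 X) (β : T.resolventSet) (B : U →L[𝕜] T.Extrapolation β)
    (Z : InputSpace U) : Prop :=
  ∃ (b : ℝ≥0 → ℝ≥0 → ℝ≥0) (μ : ℝ≥0 → ℝ≥0), ClassKL b ∧ ClassKInf μ ∧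
    ∀ (t : ℝ≥0) (x₀ : X) (u : ℝ → U), Z.mem t u →
      ∃ x : X, T.embed β x = T.mildSolution β B x₀ u t ∧
        ‖x‖₊ ≤ b ‖x₀‖₊ t + μ (Z.norm t u)

/-- `Z`-iISS: `x(t) ∈ X` and `‖x(t)‖ ≤ b(‖x₀‖, t) + θ(∫₀ᵗ μ(‖u(s)‖) ds)`. The integral may be
infinite, in which case the inequality is understood to hold. -/
def IsIISS (T : C0Semigroup 𝕜 X) (β : T.resolventSet) (B : U →L[𝕜] T.Extrapolation β)
    (Z : InputSpace U) : Prop :=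
  ∃ (b : ℝ≥0 → ℝ≥0 → ℝ≥0) (θ μ : ℝ≥0 → ℝ≥0), ClassKL b ∧ ClassKInf θ ∧ ClassK μ ∧
    ∀ (t : ℝ≥0) (x₀ : X) (u : ℝ → U), Z.mem t u →
      ∃ x : X, T.embed β x = T.mildSolution β B x₀ u t ∧
        (energy μ t u ≠ ∞ → ‖x‖₊ ≤ b ‖x₀‖₊ t + θ (energy μ t u).toNNReal)

/-- `Z`-UBEBS: `x(t) ∈ X` and `‖x(t)‖ ≤ γ(‖x₀‖) + θ(∫₀ᵗ μ(‖u(s)‖) ds) + c`. The integral may be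
infinite, in which case the inequality is understood to hold. -/
def IsUBEBS (T : C0Semigroup 𝕜 X) (β : T.resolventSet) (B : U →L[𝕜] T.Extrapolation β)
    (Z : InputSpace U) : Prop :=
  ∃ (γ θ μ : ℝ≥0 → ℝ≥0) (c : ℝ≥0), ClassKInf γ ∧ ClassKInf θ ∧ ClassK μ ∧ 0 < c ∧
    ∀ (t : ℝ≥0) (x₀ : X) (u : ℝ → U), Z.mem t u →
      ∃ x : X, T.embed β x = T.mildSolution β B x₀ u t ∧
        (energy μ t u ≠ ∞ → ‖x‖₊ ≤ γ ‖x₀‖₊ + θ (energy μ t u).toNNReal + c)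

end C0Semigroup

end

open MeasureTheory Filter Topology Set
open scoped NNReal ENNReal

noncomputable section

/-! ### Young functions -/

/-! Statement (i) is the hub: it implies (ii) and (iii), and each of those implies it. By linearity
the state is a free orbit plus `inputMap`, and the orbit is governed by exponential stability, which
follows from any `𝒦ℒ` estimate with zero input.

From (i): the `E_Φ` gain must be rewritten through integrals. For (iii), convexity gives ‖u‖_Φ ≤ 1 +
∫Φ(‖u‖), and the 1 goes into the constant c. For (ii) no constant is allowed.
`IsYoungFunction.exists_luxemburgNorm_le` provides ‖u‖_Φ ≤ θ(∫μ(‖u‖)) with μ(s) = Φ(s²) + Φ(√s) and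
θ the inverse of `youngRate`; the estimate behind it is `IsYoungFunction.youngRate_mul_le`.

Towards (i): only an integral bound for bounded inputs, up to a constant, is needed.
`ClassK.exists_young` replaces μ by μ(1) + Φ with Φ a Young function. The constant μ(1) contributes
μ(1)t to the integral, which is harmless on intervals of a fixed length h; stability with ‖T(h)‖ ≤
1/2 then carries the bound to all t (`inputMap_bound_of_short`). So inputs with ∫Φ(‖u‖) ≤ 1 produce
states of norm at most D. Scaling turns this into a bound linear in the Luxemburg norm, and density
extends it to `E_Φ` (`inputMap_bound_eOrlicz`). -/

theorem IsYoungFunction.exists_supporting {Φ : ℝ≥0 → ℝ≥0} (hΦ : IsYoungFunction Φ) :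
    ∃ φ : ℝ≥0 → ℝ≥0, Monotone φ ∧ (∀ s, 0 < s → 0 < φ s) ∧
      ∀ x y : ℝ≥0, (Φ x : ℝ) + φ x * (y - x) ≤ Φ y := by
  obtain ⟨φ, -, hmono, -, hpos, -, hint⟩ := hΦ
  refine ⟨φ, hmono, hpos, fun x y => ?_⟩
  have hf : Monotone fun s : ℝ => (φ (Real.toNNReal s) : ℝ) :=
    fun a b hab => NNReal.coe_le_coe.2 (hmono (Real.toNNReal_mono hab))
  have hii : ∀ a b : ℝ, IntervalIntegrable (fun s : ℝ => (φ (Real.toNNReal s) : ℝ)) volume a b :=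
    fun a b => hf.intervalIntegrable
  have e : ∀ t : ℝ≥0, (Φ t : ℝ) = ∫ s in (0 : ℝ)..t, (φ (Real.toNNReal s) : ℝ) := fun t => by
    rw [hint t, intervalIntegral.integral_of_le t.coe_nonneg, integral_Ioc_eq_integral_Ioo]
  have hsub : (Φ y : ℝ) - Φ x = ∫ s in (x : ℝ)..y, (φ (Real.toNNReal s) : ℝ) := by
    rw [e y, e x, intervalIntegral.integral_interval_sub_left (hii _ _) (hii _ _)]
  rcases le_total (x : ℝ) y with hxy | hxy
  · have := intervalIntegral.integral_mono_on hxy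
      (intervalIntegrable_const (c := (φ x : ℝ)) (μ := volume)) (hii x y) fun s hs => by
        simpa using hf hs.1
    rw [intervalIntegral.integral_const, smul_eq_mul, ← hsub] at this
    linarith
  · have := intervalIntegral.integral_mono_on hxy (hii y x)
      (intervalIntegrable_const (c := (φ x : ℝ)) (μ := volume)) fun s hs => by
        simpa using hf hs.2
    rw [intervalIntegral.integral_const, smul_eq_mul, intervalIntegral.integral_symm, ← hsub] at this
    linarith

theorem IsYoungFunction.map_zero {Φ : ℝ≥0 → ℝ≥0} (hΦ : IsYoungFunction Φ) : Φ 0 = 0 := by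
  obtain ⟨φ, -, -, -, -, -, hint⟩ := hΦ
  simpa using hint 0

theorem IsYoungFunction.strictMono {Φ : ℝ≥0 → ℝ≥0} (hΦ : IsYoungFunction Φ) : StrictMono Φ := by
  obtain ⟨φ, -, hpos, hsup⟩ := hΦ.exists_supporting
  intro x y hxy
  have hxy' : (x : ℝ) < y := hxy
  have h1 := hsup x ((x + y) / 2)
  have h2 := hsup ((x + y) / 2) y
  have h3 : (0 : ℝ) < φ ((x + y) / 2) :=
    hpos _ (half_pos (lt_of_lt_of_le (lt_of_le_of_lt (zero_le) hxy) le_add_self))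
  push_cast at h1 h2
  have h4 : 0 ≤ (φ x : ℝ) * ((x + y) / 2 - x) := mul_nonneg (φ x).2 (by linarith)
  have h5 : 0 < (φ ((x + y) / 2) : ℝ) * (y - (x + y) / 2) := mul_pos h3 (by linarith)
  exact NNReal.coe_lt_coe.1 (by linarith)

theorem IsYoungFunction.pos {Φ : ℝ≥0 → ℝ≥0} (hΦ : IsYoungFunction Φ) {s : ℝ≥0} (hs : 0 < s) :
    0 < Φ s := by
  simpa [hΦ.map_zero] using hΦ.strictMono hs

theorem IsYoungFunction.continuous {Φ : ℝ≥0 → ℝ≥0} (hΦ : IsYoungFunction Φ) : Continuous Φ := by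
  obtain ⟨φ, -, hmono, -, -, -, hint⟩ := hΦ
  have hf : Monotone fun s : ℝ => (φ (Real.toNNReal s) : ℝ) :=
    fun a b hab => NNReal.coe_le_coe.2 (hmono (Real.toNNReal_mono hab))
  have h := intervalIntegral.continuous_primitive (μ := volume)
    (fun a b => hf.intervalIntegrable) 0
  refine NNReal.isEmbedding_coe.continuous_iff.2 ((h.comp NNReal.continuous_coe).congr fun t => ?_)
  rw [Function.comp_apply, Function.comp_apply, hint t,
    intervalIntegral.integral_of_le t.coe_nonneg, integral_Ioc_eq_integral_Ioo]

/-- Young functions are convex. -/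
theorem IsYoungFunction.map_combo_le {Φ : ℝ≥0 → ℝ≥0} (hΦ : IsYoungFunction Φ) {a b : ℝ≥0}
    (hab : a + b = 1) (x y : ℝ≥0) : Φ (a * x + b * y) ≤ a * Φ x + b * Φ y := by
  obtain ⟨φ, -, -, hsup⟩ := hΦ.exists_supporting
  have h1 := mul_le_mul_of_nonneg_left (hsup (a * x + b * y) x) a.2
  have h2 := mul_le_mul_of_nonneg_left (hsup (a * x + b * y) y) b.2
  have hab' : (b : ℝ) = 1 - a := by
    have : (a : ℝ) + b = 1 := by exact_mod_cast hab
    linarith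
  rw [← NNReal.coe_le_coe]
  simp only [NNReal.val_eq_coe, NNReal.coe_add, NNReal.coe_mul] at h1 h2 ⊢
  rw [hab'] at h1 h2 ⊢
  linarith

theorem IsYoungFunction.map_mul_le {Φ : ℝ≥0 → ℝ≥0} (hΦ : IsYoungFunction Φ) {c : ℝ≥0}
    (hc : c ≤ 1) (x : ℝ≥0) : Φ (c * x) ≤ c * Φ x := by
  simpa [hΦ.map_zero] using hΦ.map_combo_le (add_tsub_cancel_of_le hc) x 0

/-- For s ≥ 1 convexity and Φ(0) = 0 give Φ(1) ≤ Φ(s)/s. This linear growth from below is what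
embeds Orlicz spaces on bounded intervals into L¹. -/
theorem IsYoungFunction.le_one_add {Φ : ℝ≥0 → ℝ≥0} (hΦ : IsYoungFunction Φ) (s : ℝ≥0) :
    s ≤ 1 + (Φ 1)⁻¹ * Φ s := by
  rcases le_total s 1 with h | h
  · exact h.trans le_self_add
  · have hs : 0 < s := one_pos.trans_le h
    have h1 := hΦ.map_mul_le (inv_le_one_of_one_le₀ h) s
    rw [inv_mul_cancel₀ hs.ne', ← div_eq_inv_mul, le_div_iff₀ hs] at h1
    refine le_trans ?_ le_add_self
    rw [← div_eq_inv_mul, le_div_iff₀ (hΦ.pos one_pos), mul_comm]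
    exact h1

/-- Every function of class `𝒦` is dominated by a Young function, up to an additive constant. -/
theorem ClassK.exists_young {μ : ℝ≥0 → ℝ≥0} (hμ : ClassK μ) :
    ∃ Φ : ℝ≥0 → ℝ≥0, IsYoungFunction Φ ∧ ∀ s, μ s ≤ μ 1 + Φ s := by
  -- The term s forces φ → ∞ even when μ is bounded. The other term gives, for s ≥ 1, Φ(s) ≥ ∫
  -- 2μ(2r) dr over (s/2, s) ≥ sμ(s) ≥ μ(s).
  set φ : ℝ≥0 → ℝ≥0 := fun s => s + 2 * μ (2 * s) with hφ
  have hc : Continuous φ := by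
    have := hμ.continuous
    fun_prop
  have hm : Monotone φ := fun a b hab =>
    add_le_add hab (mul_le_mul_right (hμ.strictMono.monotone (mul_le_mul_right hab 2)) 2)
  have hnn : ∀ t : ℝ≥0, 0 ≤ ∫ s in Ioo (0 : ℝ) t, (φ (Real.toNNReal s) : ℝ) := fun t =>
    integral_nonneg fun s => (φ _).2
  set Φ : ℝ≥0 → ℝ≥0 := fun t => ⟨_, hnn t⟩ with hΦ
  have hY : IsYoungFunction Φ := by
    refine ⟨φ, fun s => hc.continuousWithinAt, hm, by simp [hφ, hμ.zero],
      fun s hs => hs.trans_le le_self_add,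
      tendsto_atTop_mono (fun s => le_self_add) tendsto_id, fun t => rfl⟩
  refine ⟨Φ, hY, fun s => ?_⟩
  rcases le_total s 1 with h | h
  · exact (hμ.strictMono.monotone h).trans le_self_add
  refine le_trans ?_ le_add_self
  have hii : ∀ a b : ℝ, IntervalIntegrable (fun s : ℝ => (φ (Real.toNNReal s) : ℝ)) volume a b :=
    fun a b => Continuous.intervalIntegrable (by fun_prop) _ _
  have e : (Φ s : ℝ) = ∫ r in (0 : ℝ)..s, (φ (Real.toNNReal r) : ℝ) := by
    rw [intervalIntegral.integral_of_le s.coe_nonneg, integral_Ioc_eq_integral_Ioo]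
    rfl
  have hs2 : (s / 2 : ℝ) ≤ s := half_le_self s.2
  have h0 : 0 ≤ ∫ r in (0 : ℝ)..(s / 2 : ℝ), (φ (Real.toNNReal r) : ℝ) :=
    intervalIntegral.integral_nonneg (div_nonneg s.2 zero_le_two) fun r _ => (φ _).2
  have h1 := intervalIntegral.integral_mono_on hs2
      (intervalIntegrable_const (c := (2 * μ s : ℝ)) (μ := volume)) (hii _ _) fun r hr => by
        have h2 : s ≤ 2 * r.toNNReal := by
          rw [← NNReal.coe_le_coe, NNReal.coe_mul, Real.coe_toNNReal _
            ((div_nonneg s.2 zero_le_two).trans hr.1)]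
          have := hr.1
          push_cast
          linarith
        have h3 : 2 * μ s ≤ φ r.toNNReal :=
          (mul_le_mul_right (hμ.strictMono.monotone h2) 2).trans le_add_self
        exact_mod_cast h3
  rw [intervalIntegral.integral_const, smul_eq_mul] at h1
  have h2 := intervalIntegral.integral_add_adjacent_intervals (hii 0 (s / 2)) (hii (s / 2) s)
  have h4 : (1 : ℝ) ≤ s := h
  have h5 : (μ s : ℝ) ≤ s * μ s := le_mul_of_one_le_left (μ s).2 h4
  rw [← NNReal.coe_le_coe]
  linarith

/-! ### The energy of an input and the Luxemburg norm -/

section Energy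

variable {U : Type*} [NormedAddCommGroup U]

theorem energy_mono {μ ν : ℝ≥0 → ℝ≥0} {s t : ℝ≥0} {u : ℝ → U} (h : ∀ r, μ r ≤ ν r) (hst : s ≤ t) :
    energy μ s u ≤ energy ν t u :=
  lintegral_mono' (Measure.restrict_mono (Ioo_subset_Ioo_right (NNReal.coe_le_coe.2 hst)) le_rfl)
    fun s => ENNReal.coe_le_coe.2 (h ‖u s‖₊)

theorem energy_const_mul (c : ℝ≥0) (μ : ℝ≥0 → ℝ≥0) (t : ℝ≥0) (u : ℝ → U) :
    energy (fun r => c * μ r) t u = c * energy μ t u := by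
  simp only [energy, ENNReal.coe_mul]
  exact lintegral_const_mul' _ _ ENNReal.coe_ne_top

theorem energy_const_add (c : ℝ≥0) (μ : ℝ≥0 → ℝ≥0) (t : ℝ≥0) (u : ℝ → U) :
    energy (fun r => c + μ r) t u = c * t + energy μ t u := by
  simp only [energy, ENNReal.coe_add]
  rw [lintegral_add_left measurable_const, lintegral_const]
  simp [intervalMeasure]

instance (t : ℝ≥0) : IsFiniteMeasure (intervalMeasure t) := by
  unfold intervalMeasure
  infer_instance

theorem luxemburgNorm_le {Φ : ℝ≥0 → ℝ≥0} {t k : ℝ≥0} {u : ℝ → U} (hk : 0 < k)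
    (h : energy (fun r => Φ (k⁻¹ * r)) t u ≤ 1) : luxemburgNorm Φ t u ≤ k :=
  csInf_le' ⟨hk, h⟩

/-- With E the energy, convexity yields Φ(r/(1+E)) ≤ Φ(r)/(1+E), so k = 1 + E is admissible in the
infimum. -/
theorem luxemburgNorm_le_one_add {Φ : ℝ≥0 → ℝ≥0} (hΦ : IsYoungFunction Φ) {t : ℝ≥0} {u : ℝ → U}
    (h : energy Φ t u ≠ ∞) : luxemburgNorm Φ t u ≤ 1 + (energy Φ t u).toNNReal := by
  have hk : 0 < 1 + (energy Φ t u).toNNReal := one_pos.trans_le le_self_add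
  refine luxemburgNorm_le hk ?_
  calc _ ≤ energy (fun r => (1 + (energy Φ t u).toNNReal)⁻¹ * Φ r) t u :=
        energy_mono (fun r => hΦ.map_mul_le (inv_le_one_of_one_le₀ le_self_add) r) le_rfl
    _ = ((1 + (energy Φ t u).toNNReal)⁻¹ : ℝ≥0) * ((energy Φ t u).toNNReal : ℝ≥0) := by
        rw [energy_const_mul, ENNReal.coe_toNNReal h]
    _ ≤ 1 := by
        rw [← ENNReal.coe_mul, ← ENNReal.coe_one, ENNReal.coe_le_coe, ← div_eq_inv_mul,
          div_le_one₀ hk]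
        exact le_add_self

theorem MemOrlicz.energy_le_one {Φ : ℝ≥0 → ℝ≥0} (hΦ : IsYoungFunction Φ) {t k : ℝ≥0} {u : ℝ → U}
    (hu : MemOrlicz Φ t u) (hk : luxemburgNorm Φ t u < k) :
    energy (fun r => Φ (k⁻¹ * r)) t u ≤ 1 := by
  -- In `ℝ≥0` the infimum of the empty set is 0, so a small norm means nothing until an admissible k
  -- is exhibited; this is where membership in the Orlicz space enters.
  have hne : {k : ℝ≥0 | 0 < k ∧ energy (fun r => Φ (k⁻¹ * r)) t u ≤ 1}.Nonempty := by
    obtain ⟨-, k, hk, hfin⟩ := hu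
    set E := energy (fun r => Φ (k⁻¹ * r)) t u with hE
    have hp : 0 < 1 + E.toNNReal := one_pos.trans_le le_self_add
    refine ⟨k * (1 + E.toNNReal), mul_pos hk hp, ?_⟩
    calc _ ≤ energy (fun r => (1 + E.toNNReal)⁻¹ * Φ (k⁻¹ * r)) t u := by
          refine energy_mono (fun r => ?_) le_rfl
          rw [mul_inv_rev, mul_assoc]
          exact hΦ.map_mul_le (inv_le_one_of_one_le₀ le_self_add) _
      _ = ((1 + E.toNNReal)⁻¹ : ℝ≥0) * (E.toNNReal : ℝ≥0) := by
          rw [energy_const_mul, ENNReal.coe_toNNReal hfin.ne]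
      _ ≤ 1 := by
          rw [← ENNReal.coe_mul, ← ENNReal.coe_one, ENNReal.coe_le_coe, ← div_eq_inv_mul,
            div_le_one₀ hp]
          exact le_add_self
  obtain ⟨k', ⟨hk'0, hk'⟩, hlt⟩ := exists_lt_of_csInf_lt hne hk
  exact (energy_mono (fun r => hΦ.strictMono.monotone
    (mul_le_mul_left (inv_anti₀ hk'0 hlt.le) r)) le_rfl).trans hk'

/-- The triangle inequality for the Luxemburg norm. -/
theorem energy_le_one_of_norm_le {Φ : ℝ≥0 → ℝ≥0} (hΦ : IsYoungFunction Φ) {t a b : ℝ≥0}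
    {u v w : ℝ → U} (ha : 0 < a) (hb : 0 < b) (hv : AEStronglyMeasurable v (intervalMeasure t))
    (hw : ∀ s, ‖w s‖₊ ≤ ‖v s‖₊ + ‖u s‖₊)
    (hva : energy (fun r => Φ (a⁻¹ * r)) t v ≤ 1) (hub : energy (fun r => Φ (b⁻¹ * r)) t u ≤ 1) :
    energy (fun r => Φ ((a + b)⁻¹ * r)) t w ≤ 1 := by
  have hab : 0 < a + b := add_pos ha hb
  have hsum : a / (a + b) + b / (a + b) = 1 := by rw [← add_div, div_self hab.ne']
  have hm : AEMeasurable (fun s => ((a / (a + b) * Φ (a⁻¹ * ‖v s‖₊) : ℝ≥0) : ℝ≥0∞))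
      (intervalMeasure t) := by
    have h1 : AEMeasurable (fun s => ‖v s‖₊) (intervalMeasure t) := hv.nnnorm.aemeasurable
    have h2 : Measurable fun r : ℝ≥0 => ((a / (a + b) * Φ (a⁻¹ * r) : ℝ≥0) : ℝ≥0∞) := by
      have := hΦ.continuous
      exact Continuous.measurable (by fun_prop)
    exact h2.comp_aemeasurable h1
  calc _ ≤ ∫⁻ s, (((a / (a + b) * Φ (a⁻¹ * ‖v s‖₊) : ℝ≥0) : ℝ≥0∞) +
          ((b / (a + b) * Φ (b⁻¹ * ‖u s‖₊) : ℝ≥0) : ℝ≥0∞)) ∂(intervalMeasure t) := by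
        refine lintegral_mono fun s => ?_
        rw [← ENNReal.coe_add, ENNReal.coe_le_coe]
        refine le_trans (hΦ.strictMono.monotone ?_)
          (hΦ.map_combo_le hsum (a⁻¹ * ‖v s‖₊) (b⁻¹ * ‖u s‖₊))
        -- (‖v‖ + ‖u‖)/(a + b) is the convex combination of ‖v‖/a and ‖u‖/b with weights a/(a+b) and
        -- b/(a+b).
        refine (mul_le_mul_right (hw s) _).trans_eq ?_
        field_simp
    _ = (a / (a + b) : ℝ≥0) * energy (fun r => Φ (a⁻¹ * r)) t v +
          (b / (a + b) : ℝ≥0) * energy (fun r => Φ (b⁻¹ * r)) t u := by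
        rw [lintegral_add_left' hm, ← energy_const_mul, ← energy_const_mul]
        rfl
    _ ≤ (a / (a + b) : ℝ≥0) * 1 + (b / (a + b) : ℝ≥0) * 1 := by gcongr
    _ = 1 := by rw [mul_one, mul_one, ← ENNReal.coe_add, hsum, ENNReal.coe_one]

theorem MemLp.energy_lt_top {μ : ℝ≥0 → ℝ≥0} (hμ : Monotone μ) {t : ℝ≥0} {u : ℝ → U}
    (hu : MemLp u ∞ (intervalMeasure t)) : energy μ t u < ∞ := by
  have hfin : eLpNormEssSup u (intervalMeasure t) ≠ ∞ := by
    simpa only [eLpNorm_exponent_top] using hu.2.ne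
  calc energy μ t u ≤ ∫⁻ _, (μ (eLpNormEssSup u (intervalMeasure t)).toNNReal : ℝ≥0∞)
          ∂(intervalMeasure t) := by
        refine lintegral_mono_ae ?_
        filter_upwards [ae_le_eLpNormEssSup (f := u) (μ := intervalMeasure t)] with s hs
        exact ENNReal.coe_le_coe.2 (hμ (by simpa using ENNReal.toNNReal_mono hfin hs))
    _ < ∞ := by
        rw [lintegral_const]
        exact ENNReal.mul_lt_top ENNReal.coe_lt_top (measure_lt_top _ _)

theorem MemLp.memOrlicz {Φ : ℝ≥0 → ℝ≥0} (hΦ : IsYoungFunction Φ) {t : ℝ≥0} {u : ℝ → U}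
    (hu : MemLp u ∞ (intervalMeasure t)) : MemOrlicz Φ t u :=
  ⟨hu.1, 1, one_pos, MemLp.energy_lt_top
    (fun _ _ h => hΦ.strictMono.monotone (mul_le_mul_right h _)) hu⟩

theorem luxemburgNorm_zero {Φ : ℝ≥0 → ℝ≥0} (hΦ : IsYoungFunction Φ) (t : ℝ≥0) :
    luxemburgNorm Φ t (0 : ℝ → U) = 0 := by
  refine le_antisymm (le_of_forall_pos_le_add fun ε hε => ?_) zero_le
  rw [zero_add]
  exact luxemburgNorm_le hε (by simp [energy, hΦ.map_zero])

theorem MemLp.mem_eOrlicz {Φ : ℝ≥0 → ℝ≥0} (hΦ : IsYoungFunction Φ) {t : ℝ≥0} {u : ℝ → U}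
    (hu : MemLp u ∞ (intervalMeasure t)) : (EOrlicz U Φ).mem t u :=
  ⟨MemLp.memOrlicz hΦ hu, fun ε hε => ⟨u, hu, by rwa [sub_self, luxemburgNorm_zero hΦ]⟩⟩

theorem MemOrlicz.sub {Φ : ℝ≥0 → ℝ≥0} (hΦ : IsYoungFunction Φ) {t : ℝ≥0} {u v : ℝ → U}
    (hu : MemOrlicz Φ t u) (hv : MemOrlicz Φ t v) : MemOrlicz Φ t (u - v) := by
  have h1 := hu.energy_le_one hΦ (lt_add_one _)
  have h2 := hv.energy_le_one hΦ (lt_add_one _)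
  have hp : ∀ x : ℝ≥0, 0 < x + 1 := fun x => one_pos.trans_le le_add_self
  exact ⟨hu.1.sub hv.1, _, add_pos (hp _) (hp _), (energy_le_one_of_norm_le hΦ (hp _) (hp _) hu.1
    (fun s => nnnorm_sub_le (u s) (v s)) h1 h2).trans_lt ENNReal.one_lt_top⟩

theorem lintegral_nnnorm_le_of_energy_le_one {Φ : ℝ≥0 → ℝ≥0} (hΦ : IsYoungFunction Φ)
    {t k : ℝ≥0} {u : ℝ → U} (hk : 0 < k) (h : energy (fun r => Φ (k⁻¹ * r)) t u ≤ 1) :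
    ∫⁻ s, (‖u s‖₊ : ℝ≥0∞) ∂(intervalMeasure t) ≤ (k * (t + (Φ 1)⁻¹) : ℝ≥0) := by
  calc _ ≤ energy (fun r => k * (1 + (Φ 1)⁻¹ * Φ (k⁻¹ * r))) t u := by
        refine lintegral_mono fun s => ENNReal.coe_le_coe.2 ?_
        have := mul_le_mul_right (hΦ.le_one_add (k⁻¹ * ‖u s‖₊)) k
        rwa [mul_inv_cancel_left₀ hk.ne'] at this
    _ = k * (t + ((Φ 1)⁻¹ : ℝ≥0) * energy (fun r => Φ (k⁻¹ * r)) t u) := by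
        rw [energy_const_mul, energy_const_add, energy_const_mul, ENNReal.coe_one, one_mul]
    _ ≤ k * (t + ((Φ 1)⁻¹ : ℝ≥0) * 1) := by gcongr
    _ = _ := by push_cast; rw [mul_one]

/-! ### Time shifts of inputs. -/

theorem measurePreserving_add_left_Ioo (a t : ℝ≥0) :
    MeasurePreserving (fun s : ℝ => a + s) (intervalMeasure t)
      (volume.restrict (Ioo (a : ℝ) (a + t : ℝ≥0))) := by
  have h := (measurePreserving_add_left (volume : Measure ℝ) (a : ℝ)).restrict_preimage
    (measurableSet_Ioo (a := (a : ℝ)) (b := (a + t : ℝ≥0)))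
  simpa [intervalMeasure] using h

theorem restrict_Ioo_le_intervalMeasure (a t : ℝ≥0) :
    volume.restrict (Ioo (a : ℝ) t) ≤ intervalMeasure t :=
  Measure.restrict_mono (Ioo_subset_Ioo_left a.coe_nonneg) le_rfl

theorem energy_comp_add_left (μ : ℝ≥0 → ℝ≥0) (a t : ℝ≥0) (u : ℝ → U) :
    energy μ t (fun s => u (a + s)) ≤ energy μ (a + t) u := by
  have h := (measurePreserving_add_left_Ioo a t).lintegral_comp_emb
    (measurableEmbedding_addLeft (a : ℝ)) fun s => (μ ‖u s‖₊ : ℝ≥0∞)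
  exact h.trans_le (lintegral_mono' (restrict_Ioo_le_intervalMeasure a (a + t)) le_rfl)

theorem MemLp.comp_add_left {t a : ℝ≥0} {u : ℝ → U} (hu : MemLp u ∞ (intervalMeasure (a + t))) :
    MemLp (fun s => u (a + s)) ∞ (intervalMeasure t) :=
  (hu.mono_measure (restrict_Ioo_le_intervalMeasure a (a + t))).comp_measurePreserving
    (measurePreserving_add_left_Ioo a t)

/-- The function `k * min 1 (Φ(k) / Φ(k⁻²))` of class `𝒦_∞`. -/
def youngRate (Φ : ℝ≥0 → ℝ≥0) (k : ℝ≥0) : ℝ≥0 := k * min 1 (Φ k / Φ (k⁻¹ ^ 2))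

/-- The factor k is strictly increasing, and the minimum is nondecreasing and positive for k > 0,
since Φ(k) increases while Φ(k⁻²) decreases. -/
theorem IsYoungFunction.strictMono_youngRate {Φ : ℝ≥0 → ℝ≥0} (hΦ : IsYoungFunction Φ) :
    StrictMono (youngRate Φ) := by
  intro x y hxy
  have hy : 0 < y := (zero_le).trans_lt hxy
  have hpos : 0 < min 1 (Φ y / Φ (y⁻¹ ^ 2)) :=
    lt_min one_pos (div_pos (hΦ.pos hy) (hΦ.pos (by positivity)))
  rcases eq_or_ne x 0 with rfl | hx
  · simpa [youngRate] using ⟨hy, div_pos (hΦ.pos hy) (hΦ.pos (by positivity))⟩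
  have hx : 0 < x := pos_iff_ne_zero.2 hx
  have h1 : Φ x / Φ (x⁻¹ ^ 2) ≤ Φ y / Φ (y⁻¹ ^ 2) :=
    div_le_div₀ (zero_le) (hΦ.strictMono.monotone hxy.le) (hΦ.pos (by positivity))
      (hΦ.strictMono.monotone (pow_le_pow_left₀ (zero_le) (inv_anti₀ hx hxy.le) 2))
  exact (mul_le_mul_right (min_le_min le_rfl h1) x).trans_lt (mul_lt_mul_of_pos_right hxy hpos)

theorem IsYoungFunction.continuous_youngRate {Φ : ℝ≥0 → ℝ≥0} (hΦ : IsYoungFunction Φ) :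
    Continuous (youngRate Φ) := by
  have hc := hΦ.continuous
  refine continuous_iff_continuousAt.2 fun k => ?_
  rcases eq_or_ne k 0 with rfl | hk
  · have h0 : youngRate Φ 0 = 0 := by simp [youngRate]
    rw [ContinuousAt, h0]
    exact tendsto_of_tendsto_of_tendsto_of_le_of_le tendsto_const_nhds tendsto_id
      (fun _ => zero_le) fun k => mul_le_of_le_one_right (zero_le) (min_le_left _ _)
  · have h1 : ContinuousAt (fun k : ℝ≥0 => Φ (k⁻¹ ^ 2)) k :=
      hc.continuousAt.comp ((continuousAt_id.inv₀ hk).pow 2)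
    exact continuousAt_id.mul (continuousAt_const.min
      (hc.continuousAt.div h1 (hΦ.pos (by positivity)).ne'))

theorem IsYoungFunction.surjective_youngRate {Φ : ℝ≥0 → ℝ≥0} (hΦ : IsYoungFunction Φ) :
    Function.Surjective (youngRate Φ) := by
  intro c
  refine mem_range_of_exists_le_of_exists_ge hΦ.continuous_youngRate
    ⟨0, by simp [youngRate]⟩ ⟨max 1 c, ?_⟩
  have h1 : (1 : ℝ≥0) ≤ max 1 c := le_max_left _ _
  have h2 : (max 1 c)⁻¹ ^ 2 ≤ max 1 c :=
    (pow_le_one₀ (zero_le) (inv_le_one_of_one_le₀ h1)).trans h1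
  have h3 : 0 < (max 1 c)⁻¹ ^ 2 := by positivity
  rw [youngRate, min_eq_left ((one_le_div (hΦ.pos h3)).2 (hΦ.strictMono.monotone h2)), mul_one]
  exact le_max_right _ _

/-- For k ≥ 1 convexity gives kΦ(s/k) ≤ Φ(s), and s is at most s² or √s. For k ≤ 1: if s ≥ 1/k then
s/k ≤ s²; if s ≤ k² then s/k ≤ √s; in between, s/k ≤ k⁻², and the quotient in `youngRate` trades
Φ(k⁻²) for Φ(k) ≤ Φ(√s). -/
theorem IsYoungFunction.youngRate_mul_le {Φ : ℝ≥0 → ℝ≥0} (hΦ : IsYoungFunction Φ) {k : ℝ≥0}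
    (hk : 0 < k) (s : ℝ≥0) : youngRate Φ k * Φ (k⁻¹ * s) ≤ Φ (s ^ 2) + Φ (NNReal.sqrt s) := by
  have hm := hΦ.strictMono.monotone
  rcases le_total 1 k with h1 | h1
  · calc youngRate Φ k * Φ (k⁻¹ * s) ≤ (k * 1) * (k⁻¹ * Φ s) :=
          mul_le_mul' (mul_le_mul_right (min_le_left _ _) k)
            (hΦ.map_mul_le (inv_le_one_of_one_le₀ h1) s)
      _ = Φ s := by rw [mul_one, mul_inv_cancel_left₀ hk.ne']
      _ ≤ _ := by
        rcases le_total 1 s with h | h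
        · exact (hm (le_self_pow₀ h two_ne_zero)).trans le_self_add
        · exact (hm (NNReal.le_sqrt_iff_sq_le.2 (pow_le_of_le_one (zero_le) h two_ne_zero))).trans
            le_add_self
  have hg : youngRate Φ k ≤ min 1 (Φ k / Φ (k⁻¹ ^ 2)) := mul_le_of_le_one_left (zero_le) h1
  rcases le_total k⁻¹ s with h2 | h2
  · refine le_trans ?_ le_self_add
    calc youngRate Φ k * Φ (k⁻¹ * s) ≤ 1 * Φ (s ^ 2) :=
          mul_le_mul' (hg.trans (min_le_left _ _)) (hm (by rw [sq]; exact mul_le_mul_left h2 s))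
      _ = _ := one_mul _
  refine le_trans ?_ le_add_self
  rcases le_total s (k ^ 2) with h3 | h3
  · have h4 : NNReal.sqrt s ≤ k := NNReal.sqrt_le_iff_le_sq.2 h3
    calc youngRate Φ k * Φ (k⁻¹ * s) ≤ 1 * Φ (NNReal.sqrt s) := by
          refine mul_le_mul' (hg.trans (min_le_left _ _)) (hm ?_)
          rw [← div_eq_inv_mul, div_le_iff₀ hk]
          calc s = NNReal.sqrt s * NNReal.sqrt s := (NNReal.mul_self_sqrt s).symm
            _ ≤ _ := mul_le_mul_right h4 _
      _ = _ := one_mul _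
  · have h5 : 0 < k⁻¹ ^ 2 := by positivity
    calc youngRate Φ k * Φ (k⁻¹ * s) ≤ Φ k / Φ (k⁻¹ ^ 2) * Φ (k⁻¹ ^ 2) :=
          mul_le_mul' (hg.trans (min_le_right _ _)) (hm (by rw [sq]; exact mul_le_mul_right h2 _))
      _ = Φ k := div_mul_cancel₀ _ (hΦ.pos h5).ne'
      _ ≤ _ := hm (NNReal.le_sqrt_iff_sq_le.2 h3)

/-- Modular bounds for a suitable function of class `𝒦` control the Luxemburg norm. -/
theorem IsYoungFunction.exists_luxemburgNorm_le {Φ : ℝ≥0 → ℝ≥0} (hΦ : IsYoungFunction Φ) :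
    ∃ θ μ : ℝ≥0 → ℝ≥0, ClassKInf θ ∧ ClassK μ ∧ ∀ (t : ℝ≥0) (u : ℝ → U),
      energy μ t u ≠ ∞ → luxemburgNorm Φ t u ≤ θ (energy μ t u).toNNReal := by
  set e : ℝ≥0 ≃o ℝ≥0 := hΦ.strictMono_youngRate.orderIsoOfSurjective _ hΦ.surjective_youngRate
  have he : ∀ k, e k = youngRate Φ k := fun k => rfl
  have hc := hΦ.continuous
  have hs := hΦ.strictMono
  refine ⟨e.symm, fun s => Φ (s ^ 2) + Φ (NNReal.sqrt s),
    ⟨⟨e.symm.map_bot, e.symm.continuous, e.symm.strictMono⟩, e.symm.tendsto_atTop⟩,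
    ⟨by simp [hΦ.map_zero], by fun_prop, fun x y hxy => ?_⟩, fun t u hfin => ?_⟩
  · exact add_lt_add (hs (pow_lt_pow_left₀ hxy (zero_le) two_ne_zero))
      (hs (NNReal.sqrt_lt_sqrt.2 hxy))
  · set E := energy (fun s => Φ (s ^ 2) + Φ (NNReal.sqrt s)) t u
    -- The slack ε keeps k positive when the energy vanishes.
    refine le_of_forall_pos_le_add fun ε hε => ?_
    set k := e.symm E.toNNReal + ε
    have hk : 0 < k := hε.trans_le le_add_self
    have hEk : E.toNNReal ≤ youngRate Φ k := by
      rw [← he, ← e.symm_apply_le]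
      exact le_self_add
    have hr : 0 < youngRate Φ k := by
      simpa [youngRate] using hΦ.strictMono_youngRate hk
    refine luxemburgNorm_le hk ?_
    calc _ ≤ energy (fun s => (youngRate Φ k)⁻¹ * (Φ (s ^ 2) + Φ (NNReal.sqrt s))) t u := by
          refine energy_mono (fun s => ?_) le_rfl
          rw [le_inv_mul_iff₀ hr]
          exact hΦ.youngRate_mul_le hk s
      _ = ((youngRate Φ k)⁻¹ : ℝ≥0) * (E.toNNReal : ℝ≥0) := by
          rw [energy_const_mul, ENNReal.coe_toNNReal hfin]
      _ ≤ 1 := by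
          rw [← ENNReal.coe_mul, ← ENNReal.coe_one, ENNReal.coe_le_coe, ← div_eq_inv_mul,
            div_le_one₀ hr]
          exact hEk

end Energy

/-! ### The extrapolated semigroup and the input map -/

namespace C0Semigroup

variable {𝕜 X U : Type*} [RCLike 𝕜] [NormedAddCommGroup X] [NormedSpace 𝕜 X]
  [NormedAddCommGroup U] [NormedSpace 𝕜 U]

theorem embed_injective (T : C0Semigroup 𝕜 X) (β : T.resolventSet) :
    Function.Injective (T.embed β) := by
  refine (injective_iff_map_eq_zero _).2 fun x hx => ?_
  have h : ‖T.resolvent β x‖ = 0 := by rw [← norm_embed, hx, norm_zero]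
  exact T.resolvent_injective β (by rw [norm_eq_zero.1 h, _root_.map_zero])

theorem continuous_embed (T : C0Semigroup 𝕜 X) (β : T.resolventSet) : Continuous (T.embed β) :=
  AddMonoidHomClass.continuous_of_bound (T.embed β) ‖T.resolvent β‖ fun x => by
    rw [norm_embed]
    exact (T.resolvent β).le_opNorm x

theorem denseRange_embed (T : C0Semigroup 𝕜 X) (β : T.resolventSet) : DenseRange (T.embed β) :=
  UniformSpace.Completion.denseRange_coe (α := T.PreExtrapolation β)

/-- For s ≤ t, T(t)x − T(s)x = T(s)(T(t−s)x − x); the uniform bound reduces continuity from either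
side to continuity at 0. -/
theorem continuous_apply (T : C0Semigroup 𝕜 X) {M : ℝ} (hM : ∀ t, ‖T t‖ ≤ M) (x : X) :
    Continuous fun t => T t x := by
  have h0 : Tendsto (fun t => M * ‖T t x - x‖) (𝓝 0) (𝓝 0) := by
    have h1 : Tendsto (fun t => T t x) (𝓝 0) (𝓝 x) := by
      have h2 : 𝓝 (0 : ℝ≥0) = 𝓝[>] 0 ⊔ pure 0 := by
        rw [sup_comm, ← nhdsWithin_singleton, ← nhdsWithin_union, singleton_union]
        rw [Ioi_insert, ← bot_eq_zero, Ici_bot, nhdsWithin_univ]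
      rw [h2]
      refine (T.tendsto_zero x).sup (tendsto_pure_left.2 fun s hs => ?_)
      rw [T.map_zero]
      exact mem_of_mem_nhds hs
    simpa using ((h1.sub_const x).norm).const_mul M
  have key : ∀ s t : ℝ≥0, s ≤ t → ‖T t x - T s x‖ ≤ M * ‖T (nndist t s) x - x‖ := by
    intro s t hst
    obtain ⟨r, rfl⟩ := exists_add_of_le hst
    have h1 : nndist (s + r) s = r := by
      rw [NNReal.nndist_eq, add_tsub_cancel_left, tsub_eq_zero_of_le hst, max_eq_left (zero_le)]
    rw [h1, T.map_add, ContinuousLinearMap.comp_apply, ← map_sub]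
    exact (T s).le_of_opNorm_le (hM s) _
  refine continuous_iff_continuousAt.2 fun s => tendsto_iff_norm_sub_tendsto_zero.2 ?_
  have h3 : Tendsto (fun t => nndist t s) (𝓝 s) (𝓝 0) := by
    have : Continuous fun t => nndist t s := by fun_prop
    simpa using this.tendsto s
  refine squeeze_zero (fun _ => norm_nonneg _) (fun t => ?_) (h0.comp h3)
  rcases le_total s t with h | h
  · exact key s t h
  · rw [norm_sub_rev, Function.comp_apply, nndist_comm]
    exact key t s h

/-- The extension of `(β - A)⁻¹` to an isometry `X₋₁ → X`. -/
def extResolvent [CompleteSpace X] (T : C0Semigroup 𝕜 X) (β : T.resolventSet)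
    (y : T.Extrapolation β) : X :=
  UniformSpace.Completion.extension (T.preResolvent β) y

section ExtResolvent

variable (T : C0Semigroup 𝕜 X) (β : T.resolventSet)

theorem isometry_preResolvent : Isometry (T.preResolvent β) := Isometry.of_dist_eq fun _ _ => rfl

variable [CompleteSpace X]

theorem isometry_extResolvent : Isometry (T.extResolvent β) :=
  (T.isometry_preResolvent β).completion_extension

theorem extResolvent_embed (x : X) : T.extResolvent β (T.embed β x) = T.resolvent β x :=
  UniformSpace.Completion.extension_coe (T.isometry_preResolvent β).uniformContinuous (T.toPre β x)

/-- The isometry intertwines T₋₁ with T, so continuity of T₋₁ can be checked in X. -/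
theorem extResolvent_extrapolated (t : ℝ≥0) (y : T.Extrapolation β) :
    T.extResolvent β (T.extrapolated β t y) = T t (T.extResolvent β y) := by
  refine congrFun ((T.denseRange_embed β).equalizer
    ((T.isometry_extResolvent β).continuous.comp (T.extrapolated β t).continuous)
    ((T t).continuous.comp (T.isometry_extResolvent β).continuous) (funext fun x => ?_)) y
  simp only [Function.comp_apply]
  rw [extrapolated_embed, extResolvent_embed, extResolvent_embed, resolvent_comm]

end ExtResolvent

theorem extrapolated_add (T : C0Semigroup 𝕜 X) (β : T.resolventSet) (s t : ℝ≥0)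
    (y : T.Extrapolation β) :
    T.extrapolated β (s + t) y = T.extrapolated β s (T.extrapolated β t y) := by
  refine congrFun ((T.denseRange_embed β).equalizer (T.extrapolated β (s + t)).continuous
    ((T.extrapolated β s).continuous.comp (T.extrapolated β t).continuous)
    (funext fun x => ?_)) y
  simp only [Function.comp_apply]
  rw [extrapolated_embed, extrapolated_embed, extrapolated_embed, T.map_add,
    ContinuousLinearMap.comp_apply]

theorem norm_extrapolated_le (T : C0Semigroup 𝕜 X) (β : T.resolventSet) (t : ℝ≥0)
    (y : T.Extrapolation β) : ‖T.extrapolated β t y‖ ≤ ‖T t‖ * ‖y‖ := by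
  refine (T.denseRange_embed β).induction_on y
    (isClosed_le (T.extrapolated β t).continuous.norm (continuous_const.mul continuous_norm))
    fun x => ?_
  rw [extrapolated_embed, norm_embed, norm_embed, resolvent_comm]
  exact (T t).le_opNorm _

/-- Joint continuity of `(t, y) ↦ T₋₁(t) y` for a bounded semigroup. -/
theorem continuous_extrapolated [CompleteSpace X] (T : C0Semigroup 𝕜 X) (β : T.resolventSet)
    {M : ℝ} (hM : ∀ t, ‖T t‖ ≤ M) :
    Continuous fun p : ℝ≥0 × T.Extrapolation β => T.extrapolated β p.1 p.2 := by
  rw [(T.isometry_extResolvent β).isUniformInducing.isInducing.continuous_iff]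
  simp only [Function.comp_def, extResolvent_extrapolated]
  have h : Continuous fun p : ℝ≥0 × X => T p.1 p.2 := by
    refine continuous_iff_continuousAt.2 fun ⟨s, x⟩ => tendsto_iff_norm_sub_tendsto_zero.2 ?_
    have h1 : Tendsto (fun p : ℝ≥0 × X => M * ‖p.2 - x‖ + ‖T p.1 x - T s x‖) (𝓝 (s, x)) (𝓝 0) := by
      have hc := T.continuous_apply hM x
      have : Continuous fun p : ℝ≥0 × X => M * ‖p.2 - x‖ + ‖T p.1 x - T s x‖ := by fun_prop
      simpa using this.tendsto (s, x)
    refine squeeze_zero (fun _ => norm_nonneg _) (fun p => ?_) h1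
    calc ‖T p.1 p.2 - T s x‖ = ‖T p.1 (p.2 - x) + (T p.1 x - T s x)‖ := by
          rw [map_sub]; congr 1; abel
      _ ≤ _ := (norm_add_le _ _).trans
          (add_le_add_left ((T p.1).le_of_opNorm_le (hM _) _) _)
  exact h.comp (continuous_fst.prodMk ((T.isometry_extResolvent β).continuous.comp continuous_snd))

/-- The input map `u ↦ ∫₀ᵗ T₋₁(t - s) B u(s) ds`. -/
def inputMap (T : C0Semigroup 𝕜 X) (β : T.resolventSet) (B : U →L[𝕜] T.Extrapolation β)
    (t : ℝ≥0) (u : ℝ → U) : T.Extrapolation β :=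
  ∫ s, T.extrapolated β (Real.toNNReal (t - s)) (B (u s)) ∂(intervalMeasure t)

section InputMap

variable (T : C0Semigroup 𝕜 X) (β : T.resolventSet) (B : U →L[𝕜] T.Extrapolation β)

theorem mildSolution_eq (x₀ : X) (u : ℝ → U) (t : ℝ≥0) :
    T.mildSolution β B x₀ u t = T.embed β (T t x₀) + T.inputMap β B t u := rfl

theorem inputMap_zero (t : ℝ≥0) : T.inputMap β B t 0 = 0 := by
  simp [inputMap]

theorem inputMap_const_smul (t : ℝ≥0) (c : 𝕜) (u : ℝ → U) :
    T.inputMap β B t (c • u) = c • T.inputMap β B t u := by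
  have : SMulCommClass ℝ 𝕜 (T.Extrapolation β) := IsScalarTower.to_smulCommClass
  simp only [inputMap, Pi.smul_apply, map_smul]
  exact integral_smul c _

/-- An L¹ estimate holds in the weak norm of X₋₁ without any admissibility assumption on B; it
serves to identify limits of input maps. -/
theorem norm_inputMap_le {M : ℝ≥0} (hM : ∀ t, ‖T t‖ ≤ M) (t : ℝ≥0) (u : ℝ → U) :
    ‖T.inputMap β B t u‖ₑ ≤
      (M * ‖B‖₊ : ℝ≥0) * ∫⁻ s, (‖u s‖₊ : ℝ≥0∞) ∂(intervalMeasure t) := by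
  refine (enorm_integral_le_lintegral_enorm _).trans ?_
  rw [← lintegral_const_mul' _ _ ENNReal.coe_ne_top]
  refine lintegral_mono fun s => ?_
  rw [enorm_eq_nnnorm, ← ENNReal.coe_mul, ENNReal.coe_le_coe, ← NNReal.coe_le_coe]
  refine (T.norm_extrapolated_le β _ _).trans ?_
  push_cast
  rw [mul_assoc]
  exact mul_le_mul (hM _) (B.le_opNorm _) (norm_nonneg _) M.2

variable [CompleteSpace X]

theorem integrable_extrapolated {M : ℝ} (hM : ∀ t, ‖T t‖ ≤ M) {μ : Measure ℝ} {a : ℝ} {u : ℝ → U}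
    (hu : Integrable u μ) :
    Integrable (fun s => T.extrapolated β (Real.toNNReal (a - s)) (B (u s))) μ := by
  have hBu : Integrable (fun s => B (u s)) μ := B.integrable_comp hu
  have h1 : AEStronglyMeasurable (fun s : ℝ => Real.toNNReal (a - s)) μ :=
    Continuous.aestronglyMeasurable (by fun_prop)
  have h2 := h1.prodMk hBu.1
  have h3 := (T.continuous_extrapolated β hM).comp_aestronglyMeasurable h2
  exact Integrable.mono' (hBu.norm.const_mul M) h3 (ae_of_all _ fun s =>
    (T.norm_extrapolated_le β _ _).trans (mul_le_mul_of_nonneg_right (hM _) (norm_nonneg _)))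

theorem inputMap_sub {M : ℝ} (hM : ∀ t, ‖T t‖ ≤ M) {t : ℝ≥0} {u v : ℝ → U}
    (hu : Integrable u (intervalMeasure t)) (hv : Integrable v (intervalMeasure t)) :
    T.inputMap β B t (u - v) = T.inputMap β B t u - T.inputMap β B t v := by
  simp only [inputMap, Pi.sub_apply, map_sub]
  exact integral_sub (T.integrable_extrapolated β B hM hu) (T.integrable_extrapolated β B hM hv)

/-- The cocycle property of the input map. -/
theorem inputMap_add {M : ℝ} (hM : ∀ t, ‖T t‖ ≤ M) {s h : ℝ≥0} {u : ℝ → U}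
    (hu : Integrable u (intervalMeasure (s + h))) :
    T.inputMap β B (s + h) u =
      T.extrapolated β h (T.inputMap β B s u) + T.inputMap β B h (fun r => u (s + r)) := by
  have hs : (s : ℝ) ≤ (s + h : ℝ≥0) := NNReal.coe_le_coe.2 le_self_add
  set f : ℝ → T.Extrapolation β :=
    fun r => T.extrapolated β (Real.toNNReal ((s + h : ℝ≥0) - r)) (B (u r)) with hf
  have hfi : IntegrableOn f (Ioo 0 (s + h : ℝ≥0)) := T.integrable_extrapolated β B hM hu
  have hus : Integrable u (intervalMeasure s) :=
    hu.mono_measure (Measure.restrict_mono (Ioo_subset_Ioo_right hs) le_rfl)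
  have h1 : T.inputMap β B (s + h) u = (∫ r in Ioo 0 (s : ℝ), f r) +
      ∫ r in Ioo (s : ℝ) (s + h : ℝ≥0), f r := by
    have hii : IntegrableOn f (Ioc 0 (s + h : ℝ≥0)) := by
      rwa [integrableOn_Ioc_iff_integrableOn_Ioo]
    have := intervalIntegral.integral_add_adjacent_intervals (f := f) (μ := volume)
      ((intervalIntegrable_iff_integrableOn_Ioc_of_le s.coe_nonneg).2
        (hii.mono_set (Ioc_subset_Ioc_right hs)))
      ((intervalIntegrable_iff_integrableOn_Ioc_of_le hs).2
        (hii.mono_set (Ioc_subset_Ioc_left s.coe_nonneg)))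
    rw [intervalIntegral.integral_of_le s.coe_nonneg, intervalIntegral.integral_of_le hs,
      intervalIntegral.integral_of_le (s.coe_nonneg.trans hs), integral_Ioc_eq_integral_Ioo,
      integral_Ioc_eq_integral_Ioo, integral_Ioc_eq_integral_Ioo] at this
    exact this.symm
  rw [h1]
  congr 1
  · rw [inputMap, ← ContinuousLinearMap.integral_comp_comm _
      (T.integrable_extrapolated β B hM hus)]
    refine setIntegral_congr_fun measurableSet_Ioo fun r hr => ?_
    simp only [hf]
    have e : Real.toNNReal (((s + h : ℝ≥0) : ℝ) - r) = h + Real.toNNReal (s - r) := by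
      rw [← NNReal.coe_inj, NNReal.coe_add h, Real.coe_toNNReal _ (sub_nonneg.2 hr.2.le),
        Real.coe_toNNReal _ (sub_nonneg.2 (hr.2.le.trans hs)), NNReal.coe_add]
      ring
    rw [← extrapolated_add, e]
  · rw [inputMap, ← (measurePreserving_add_left_Ioo s h).integral_comp
      (measurableEmbedding_addLeft (s : ℝ))]
    refine integral_congr_ae (ae_of_all _ fun r => ?_)
    simp only [hf]
    congr 2
    push_cast
    congr 1
    ring

end InputMap

/-- A bounded semigroup with `‖T(h)‖ ≤ e⁻¹` for some `h > 0` is exponentially stable. -/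
theorem exponentiallyStable_of_norm_le (T : C0Semigroup 𝕜 X) {M : ℝ} (hM : ∀ t, ‖T t‖ ≤ M)
    {h : ℝ≥0} (hh : 0 < h) (hT : ‖T h‖ ≤ Real.exp (-1)) : T.ExponentiallyStable := by
  have hpow : ∀ (n : ℕ) (r : ℝ≥0), ‖T (n * h + r)‖ ≤ Real.exp (-n) * M := by
    intro n
    induction n with
    | zero => intro r; simpa using hM r
    | succ n ih =>
      intro r
      have e : ((n + 1 : ℕ) : ℝ≥0) * h + r = h + (n * h + r) := by push_cast; ring
      rw [e, T.map_add]
      refine (ContinuousLinearMap.opNorm_comp_le _ _).trans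
        ((mul_le_mul hT (ih r) (norm_nonneg _) (Real.exp_nonneg _)).trans_eq ?_)
      rw [← mul_assoc, ← Real.exp_add]
      push_cast
      ring_nf
  have hM0 : 0 ≤ M := (norm_nonneg _).trans (hM 0)
  -- The factor e pays for rounding t/h down; M + 1 is positive even if M = 0, as may happen for X =
  -- 0.
  refine ⟨Real.exp 1 * (M + 1), (h : ℝ)⁻¹, by positivity, by positivity, fun t => ?_⟩
  have hle : (⌊t / h⌋₊ : ℝ≥0) * h ≤ t := by
    rw [← le_div_iff₀ hh]
    exact Nat.floor_le (zero_le)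
  have hlt : t / h < ⌊t / h⌋₊ + 1 := Nat.lt_floor_add_one _
  have h1 := hpow ⌊t / h⌋₊ (t - ⌊t / h⌋₊ * h)
  rw [add_tsub_cancel_of_le hle] at h1
  have h2 : (t : ℝ) / h < ⌊t / h⌋₊ + 1 := by exact_mod_cast hlt
  calc ‖T t‖ ≤ Real.exp (-⌊t / h⌋₊) * M := h1
    _ ≤ Real.exp (1 + -(h : ℝ)⁻¹ * t) * (M + 1) := by
        gcongr
        · rw [neg_mul, ← div_eq_inv_mul]
          linarith
        · linarith
    _ = _ := by rw [Real.exp_add]; ring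

theorem ExponentiallyStable.exists_bound {T : C0Semigroup 𝕜 X} (h : T.ExponentiallyStable) :
    ∃ M : ℝ≥0, ∀ t, ‖T t‖ ≤ M := by
  obtain ⟨M, ω, hM, hω, hT⟩ := h
  refine ⟨⟨M, hM.le⟩, fun t => (hT t).trans (mul_le_of_le_one_right hM.le ?_)⟩
  rw [Real.exp_le_one_iff, neg_mul, neg_nonpos]
  positivity

theorem ExponentiallyStable.exists_norm_le_half {T : C0Semigroup 𝕜 X}
    (h : T.ExponentiallyStable) : ∃ t : ℝ≥0, 0 < t ∧ ‖T t‖ ≤ 1 / 2 := by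
  obtain ⟨M, ω, hM, hω, hT⟩ := h
  have h1 : Tendsto (fun t : ℝ≥0 => M * Real.exp (-ω * t)) atTop (𝓝 (M * 0)) := by
    refine (Real.tendsto_exp_atBot.comp ?_).const_mul M
    exact (tendsto_const_mul_atBot_of_neg (neg_neg_of_pos hω)).2
      (NNReal.tendsto_coe_atTop.2 tendsto_id)
  rw [mul_zero] at h1
  obtain ⟨t, ht, ht0⟩ := ((h1.eventually_le_const (by norm_num : (0 : ℝ) < 1 / 2)).and
    (eventually_gt_atTop 0)).exists
  exact ⟨t, ht0, (hT t).trans ht⟩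

end C0Semigroup

/-! ### Bounds for the input map -/

namespace C0Semigroup

variable {𝕜 X U : Type*} [RCLike 𝕜] [NormedAddCommGroup X] [NormedSpace 𝕜 X]
  [NormedAddCommGroup U] [NormedSpace 𝕜 U]

/-- Testing on unit vectors gives ‖T(t)‖ ≤ b(1, t), which is bounded by b(1, 0) and eventually falls
below e⁻¹. -/
theorem exponentiallyStable_of_apply_le (T : C0Semigroup 𝕜 X) {b : ℝ≥0 → ℝ≥0 → ℝ≥0}
    (hb : ClassKL b) (h : ∀ (t : ℝ≥0) (x : X), ‖T t x‖₊ ≤ b ‖x‖₊ t) : T.ExponentiallyStable := by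
  have hT : ∀ t, ‖T t‖ ≤ b 1 t := fun t =>
    ContinuousLinearMap.opNorm_le_of_unit_norm (b 1 t).2 fun x hx => by
      have := h t x
      rw [show ‖x‖₊ = 1 from NNReal.eq hx] at this
      exact this
  have hL := hb.right 1 one_pos
  obtain ⟨t, ht, ht0⟩ := ((hL.tendsto.eventually_le_const
    (Real.toNNReal_pos.2 (Real.exp_pos (-1)))).and (eventually_gt_atTop 0)).exists
  refine T.exponentiallyStable_of_norm_le (M := b 1 0)
    (fun t => (hT t).trans (NNReal.coe_le_coe.2 (hL.strictAnti.antitone (zero_le)))) ht0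
    ((hT t).trans ?_)
  rw [← Real.coe_toNNReal _ (Real.exp_nonneg (-1))]
  exact NNReal.coe_le_coe.2 ht

section Bound

variable {T : C0Semigroup 𝕜 X} {β : T.resolventSet} {B : U →L[𝕜] T.Extrapolation β}

theorem inputMap_bound_scale {Φ : ℝ≥0 → ℝ≥0} {D : ℝ≥0}
    (hD : ∀ (t : ℝ≥0) (u : ℝ → U), MemLp u ∞ (intervalMeasure t) → energy Φ t u ≤ 1 →
        ∃ x, T.embed β x = T.inputMap β B t u ∧ ‖x‖ ≤ D)
    {t k : ℝ≥0} {u : ℝ → U} (hu : MemLp u ∞ (intervalMeasure t)) (hk : 0 < k)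
    (hE : energy (fun r => Φ (k⁻¹ * r)) t u ≤ 1) :
    ∃ x, T.embed β x = T.inputMap β B t u ∧ ‖x‖ ≤ k * D := by
  have hk' : (((k : ℝ) : 𝕜)) ≠ 0 := by
    simpa using hk.ne'
  have hnorm : ‖((k : ℝ) : 𝕜)‖₊ = k := by
    ext
    simp
  obtain ⟨x, hx, hxD⟩ := hD t ((((k : ℝ) : 𝕜))⁻¹ • u) (hu.const_smul _) (by
    refine le_trans (lintegral_mono fun s => ?_) hE
    rw [Pi.smul_apply, nnnorm_smul, nnnorm_inv, hnorm])
  refine ⟨((k : ℝ) : 𝕜) • x, ?_, ?_⟩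
  · rw [_root_.map_smul, hx, inputMap_const_smul, smul_smul, mul_inv_cancel₀ hk', one_smul]
  · rw [norm_smul, ← coe_nnnorm, hnorm]
    exact mul_le_mul_of_nonneg_left hxD k.coe_nonneg

variable [CompleteSpace X]

/-- If `‖T(h)‖ ≤ 1/2`, then a modular bound for the input map on intervals of length at most `h`
extends to all intervals. -/
theorem inputMap_bound_of_short {M : ℝ} (hM : ∀ t, ‖T t‖ ≤ M) {h : ℝ≥0} (hh : 0 < h)
    (hT : ‖T h‖ ≤ 1 / 2) {Φ : ℝ≥0 → ℝ≥0} {C : ℝ≥0}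
    (hshort : ∀ (t : ℝ≥0) (u : ℝ → U), t ≤ h → MemLp u ∞ (intervalMeasure t) →
      energy Φ t u ≤ 1 → ∃ x, T.embed β x = T.inputMap β B t u ∧ ‖x‖ ≤ C)
    (t : ℝ≥0) (u : ℝ → U) (hu : MemLp u ∞ (intervalMeasure t)) (hE : energy Φ t u ≤ 1) :
    ∃ x, T.embed β x = T.inputMap β B t u ∧ ‖x‖ ≤ 2 * C := by
  have key : ∀ (n : ℕ) (t : ℝ≥0) (u : ℝ → U), t ≤ n * h → MemLp u ∞ (intervalMeasure t) →
      energy Φ t u ≤ 1 → ∃ x, T.embed β x = T.inputMap β B t u ∧ ‖x‖ ≤ 2 * C := by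
    have short : ∀ (t : ℝ≥0) (u : ℝ → U), t ≤ h → MemLp u ∞ (intervalMeasure t) →
        energy Φ t u ≤ 1 → ∃ x, T.embed β x = T.inputMap β B t u ∧ ‖x‖ ≤ 2 * C :=
      fun t u ht hu hE => by
        obtain ⟨x, hx, hxC⟩ := hshort t u ht hu hE
        exact ⟨x, hx, by linarith [C.coe_nonneg]⟩
    intro n
    induction n with
    | zero => exact fun t u ht => short t u (ht.trans (by simp))
    | succ n ih =>
      intro t u ht hu hE
      rcases le_total t h with hth | hth
      · exact short t u hth hu hE
      obtain ⟨s, rfl⟩ := exists_add_of_le hth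
      rw [add_comm h s] at *
      have hs : s ≤ n * h := by
        have : s + h ≤ n * h + h := by
          refine ht.trans_eq ?_
          push_cast
          ring
        exact le_of_add_le_add_right this
      have hss : s ≤ s + h := le_self_add
      obtain ⟨x, hx, hxC⟩ := ih s u hs
        (hu.mono_measure (Measure.restrict_mono (Ioo_subset_Ioo_right (NNReal.coe_le_coe.2 hss))
          le_rfl)) ((energy_mono (fun _ => le_rfl) hss).trans hE)
      obtain ⟨y, hy, hyC⟩ := hshort h (fun r => u (s + r)) le_rfl (MemLp.comp_add_left hu)
        ((energy_comp_add_left Φ s h u).trans hE)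
      -- The final piece has length exactly h, so the earlier state is halved: (1/2)(2C) + C = 2C,
      -- and the bound reproduces itself.
      refine ⟨T h x + y, ?_, ?_⟩
      · rw [_root_.map_add, ← extrapolated_embed, hx, hy,
          T.inputMap_add β B hM (hu.integrable le_top)]
      · have := (T h).le_of_opNorm_le hT x
        linarith [norm_add_le (T h x) y]
  obtain ⟨n, hn⟩ := exists_nat_ge (t / h)
  exact key n t u ((div_le_iff₀ hh).1 hn) hu hE

/-- For an exponentially stable semigroup, an integral estimate for bounded inputs, up to an
additive constant, yields a modular bound for the input map. -/
theorem ExponentiallyStable.exists_young_inputMap_bound (hstab : T.ExponentiallyStable)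
    {θ μ : ℝ≥0 → ℝ≥0} {c : ℝ≥0} (hθ : Monotone θ) (hμ : ClassK μ)
    (hB : ∀ (t : ℝ≥0) (u : ℝ → U), MemLp u ∞ (intervalMeasure t) →
      ∃ x, T.embed β x = T.inputMap β B t u ∧
        (energy μ t u ≠ ∞ → ‖x‖₊ ≤ θ (energy μ t u).toNNReal + c)) :
    ∃ Φ : ℝ≥0 → ℝ≥0, IsYoungFunction Φ ∧ ∃ D : ℝ≥0, ∀ (t : ℝ≥0) (u : ℝ → U),
      MemLp u ∞ (intervalMeasure t) → energy Φ t u ≤ 1 →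
        ∃ x, T.embed β x = T.inputMap β B t u ∧ ‖x‖ ≤ D := by
  obtain ⟨M, hM⟩ := hstab.exists_bound
  obtain ⟨h, hh, hT⟩ := hstab.exists_norm_le_half
  obtain ⟨Φ, hΦ, hμΦ⟩ := hμ.exists_young
  -- On an interval of length at most h, ∫Φ ≤ 1 forces ∫μ ≤ μ(1)h + 1; the factor 2 comes from
  -- passing to all intervals.
  refine ⟨Φ, hΦ, 2 * (θ (μ 1 * h + 1) + c), ?_⟩
  push_cast
  rw [← NNReal.coe_add]
  refine inputMap_bound_of_short hM hh hT fun t u ht hu hE => ?_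
  obtain ⟨x, hx, hxc⟩ := hB t u hu
  have hE' : energy μ t u ≤ (μ 1 * h + 1 : ℝ≥0) :=
    calc energy μ t u ≤ energy (fun r => μ 1 + Φ r) t u := energy_mono hμΦ le_rfl
      _ = μ 1 * t + energy Φ t u := energy_const_add _ _ _ _
      _ ≤ μ 1 * h + 1 := by gcongr
      _ = _ := by push_cast; rfl
  have hE'' : (energy μ t u).toNNReal ≤ μ 1 * h + 1 := by
    simpa only [ENNReal.toNNReal_coe] using ENNReal.toNNReal_mono ENNReal.coe_ne_top hE'
  exact ⟨x, hx, NNReal.coe_le_coe.2 ((hxc (ne_top_of_le_ne_top ENNReal.coe_ne_top hE')).trans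
    (add_le_add_left (hθ hE'') c))⟩

/-- A modular bound for the input map on bounded inputs extends by density to `E_Φ`. -/
theorem inputMap_bound_eOrlicz {M : ℝ≥0} (hM : ∀ t, ‖T t‖ ≤ M) {Φ : ℝ≥0 → ℝ≥0}
    (hΦ : IsYoungFunction Φ) {D : ℝ≥0}
    (hD : ∀ (t : ℝ≥0) (u : ℝ → U), MemLp u ∞ (intervalMeasure t) → energy Φ t u ≤ 1 →
        ∃ x, T.embed β x = T.inputMap β B t u ∧ ‖x‖ ≤ D)
    {t : ℝ≥0} {u : ℝ → U} (hu : (EOrlicz U Φ).mem t u) :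
    ∃ x, T.embed β x = T.inputMap β B t u ∧ ‖x‖ ≤ luxemburgNorm Φ t u * D := by
  obtain ⟨huO, hdense⟩ := hu
  obtain ⟨ε, -, hε, hε0⟩ := exists_seq_strictAnti_tendsto (0 : ℝ≥0)
  choose v hv hvu using fun n => hdense (ε n) (hε n)
  have huv : ∀ n, energy (fun r => Φ ((ε n)⁻¹ * r)) t (u - v n) ≤ 1 := fun n =>
    (huO.sub hΦ (MemLp.memOrlicz hΦ (hv n))).energy_le_one hΦ (hvu n)
  have hvi : ∀ n, Integrable (v n) (intervalMeasure t) := fun n => (hv n).integrable le_top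
  have hbound : ∀ n, ∀ k, 0 < k → energy (fun r => Φ (k⁻¹ * r)) t u ≤ 1 →
      ∃ x, T.embed β x = T.inputMap β B t (v n) ∧ ‖x‖ ≤ (ε n + k : ℝ≥0) * D := fun n k hk hE =>
    inputMap_bound_scale hD (hv n) (add_pos (hε n) hk) (energy_le_one_of_norm_le hΦ (hε n) hk
      (huO.1.sub (hv n).1) (fun s => by
        rw [← nnnorm_neg (v n s)]
        simpa [sub_eq_add_neg, add_comm] using nnnorm_sub_le (u s - v n s) (u s)) (huv n) hE)
  -- The particular k only produces the state x n. Injectivity of the embedding makes the bounds for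
  -- every other admissible k apply to the same x n.
  choose x hx using fun n => (hbound n _ (one_pos.trans_le le_add_self)
    (huO.energy_le_one hΦ (lt_add_one _))).imp fun _ h => h.1
  have hnorm : ∀ n k, 0 < k → energy (fun r => Φ (k⁻¹ * r)) t u ≤ 1 →
      ‖x n‖ ≤ (ε n + k : ℝ≥0) * D := fun n k hk hE => by
    obtain ⟨y, hy, hyk⟩ := hbound n k hk hE
    rwa [T.embed_injective β ((hx n).trans hy.symm)]
  -- v m − v n = (u − v n) − (u − v m) has Luxemburg norm at most ε n + ε m, so the states form a
  -- Cauchy sequence in X itself.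
  have hdiff : ∀ m n, ‖x m - x n‖ ≤ (ε n + ε m : ℝ≥0) * D := fun m n => by
    obtain ⟨y, hy, hyD⟩ := inputMap_bound_scale hD ((hv m).sub (hv n)) (add_pos (hε n) (hε m))
      (energy_le_one_of_norm_le hΦ (hε n) (hε m) (huO.1.sub (hv n).1) (fun s => by
        have := nnnorm_sub_le (u s - v n s) (u s - v m s)
        rwa [sub_sub_sub_cancel_left] at this) (huv n) (huv m))
    have : x m - x n = y := T.embed_injective β (by
      rw [map_sub, hx, hx, hy, T.inputMap_sub β B hM (hvi m) (hvi n)])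
    rwa [this]
  have hε' : Tendsto (fun n => (ε n : ℝ)) atTop (𝓝 0) := NNReal.tendsto_coe.2 hε0
  have hcauchy : CauchySeq x := by
    rw [cauchySeq_iff_tendsto_dist_atTop_0]
    have h1 : Tendsto (fun p : ℕ × ℕ => ((ε p.2 : ℝ) + ε p.1) * D) atTop (𝓝 ((0 + 0) * D)) := by
      rw [← prod_atTop_atTop_eq]
      exact ((hε'.comp tendsto_snd).add (hε'.comp tendsto_fst)).mul_const _
    rw [add_zero, zero_mul] at h1
    refine squeeze_zero (fun _ => dist_nonneg) (fun p => ?_) h1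
    rw [dist_eq_norm]
    simpa using hdiff p.1 p.2
  obtain ⟨z, hz⟩ := cauchySeq_tendsto_of_complete hcauchy
  refine ⟨z, ?_, ?_⟩
  · have hdi : ∀ n, ∫⁻ s, (‖(u - v n) s‖₊ : ℝ≥0∞) ∂(intervalMeasure t) ≤
        (ε n * (t + (Φ 1)⁻¹) : ℝ≥0) := fun n =>
      lintegral_nnnorm_le_of_energy_le_one hΦ (hε n) (huv n)
    have hui : Integrable u (intervalMeasure t) := by
      have : Integrable (u - v 0) (intervalMeasure t) :=
        ⟨huO.1.sub (hv 0).1, (hdi 0).trans_lt ENNReal.coe_lt_top⟩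
      simpa using this.add (hvi 0)
    -- Orlicz convergence implies L¹ convergence, hence convergence of the input maps in X₋₁;
    -- uniqueness of limits there shows that z is the state for u.
    have h1 : Tendsto (fun n => T.inputMap β B t (v n)) atTop (𝓝 (T.inputMap β B t u)) := by
      rw [tendsto_iff_norm_sub_tendsto_zero]
      have h2 : Tendsto (fun n => (M * ‖B‖₊ * (ε n * (t + (Φ 1)⁻¹)) : ℝ)) atTop
          (𝓝 (M * ‖B‖₊ * (0 * (t + (Φ 1)⁻¹)))) := (hε'.mul_const _).const_mul _
      rw [zero_mul, mul_zero] at h2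
      refine squeeze_zero (fun _ => norm_nonneg _) (fun n => ?_) h2
      rw [norm_sub_rev, ← T.inputMap_sub β B hM hui (hvi n)]
      have h3 := (T.norm_inputMap_le β B hM t (u - v n)).trans (mul_le_mul_right (hdi n) _)
      rw [enorm_eq_nnnorm, ← ENNReal.coe_mul, ENNReal.coe_le_coe] at h3
      exact_mod_cast h3
    refine tendsto_nhds_unique (((T.continuous_embed β).tendsto z).comp hz) ?_
    simpa only [Function.comp_def, hx] using h1
  · have h1 : ∀ k, luxemburgNorm Φ t u < k → ‖z‖ ≤ k * D := fun k hk => by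
      have h2 : Tendsto (fun n => ((ε n : ℝ) + k) * D) atTop (𝓝 ((0 + k) * D)) :=
        (hε'.add_const _).mul_const _
      rw [zero_add] at h2
      exact le_of_tendsto_of_tendsto' hz.norm h2 fun n => by
        simpa using hnorm n k ((zero_le).trans_lt hk) (huO.energy_le_one hΦ hk)
    have h3 : Tendsto (fun n => ((luxemburgNorm Φ t u : ℝ) + ε n) * D) atTop
        (𝓝 ((luxemburgNorm Φ t u + 0) * D)) := (hε'.const_add _).mul_const _
    rw [add_zero] at h3
    exact ge_of_tendsto' h3 fun n => by
      simpa using h1 (luxemburgNorm Φ t u + ε n) (lt_add_of_pos_right _ (hε n))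

/-- An integral estimate for bounded inputs, up to an additive constant, together with exponential
stability implies `E_Φ`-ISS for some Young function `Φ`. -/
theorem ExponentiallyStable.exists_isISS_eOrlicz (hstab : T.ExponentiallyStable)
    {θ μ : ℝ≥0 → ℝ≥0} {c : ℝ≥0} (hθ : Monotone θ) (hμ : ClassK μ)
    (hB : ∀ (t : ℝ≥0) (u : ℝ → U), MemLp u ∞ (intervalMeasure t) →
      ∃ x, T.embed β x = T.inputMap β B t u ∧
        (energy μ t u ≠ ∞ → ‖x‖₊ ≤ θ (energy μ t u).toNNReal + c)) :
    ∃ Φ : ℝ≥0 → ℝ≥0, IsYoungFunction Φ ∧ T.IsISS β B (EOrlicz U Φ) := by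
  obtain ⟨Φ, hΦ, D, hD⟩ := hstab.exists_young_inputMap_bound hθ hμ hB
  obtain ⟨M', hM'⟩ := hstab.exists_bound
  obtain ⟨M, ω, hM, hω, hT⟩ := hstab
  -- D + 1 in place of D keeps the gain strictly increasing and unbounded when D = 0.
  refine ⟨Φ, hΦ, fun s t => s * Real.toNNReal (M * Real.exp (-ω * t)), fun s => s * (D + 1),
    ⟨fun t => ⟨zero_mul _, by fun_prop, fun x y hxy => mul_lt_mul_of_pos_right hxy
      (Real.toNNReal_pos.2 (by positivity))⟩, fun s hs => ⟨by fun_prop, fun a b hab => ?_, ?_⟩⟩,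
    ⟨⟨zero_mul _, by fun_prop, fun x y hxy => mul_lt_mul_of_pos_right hxy (by positivity)⟩,
      tendsto_id.atTop_mul_const (by positivity)⟩, fun t x₀ u hu => ?_⟩
  · have hab' : (a : ℝ) < b := hab
    refine mul_lt_mul_of_pos_left ((Real.toNNReal_lt_toNNReal_iff (by positivity)).2
      (mul_lt_mul_of_pos_left (Real.exp_lt_exp.2 ?_) hM)) hs
    nlinarith
  · have h1 : Tendsto (fun t : ℝ≥0 => M * Real.exp (-ω * t)) atTop (𝓝 (M * 0)) := by
      refine (Real.tendsto_exp_atBot.comp ?_).const_mul M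
      exact (tendsto_const_mul_atBot_of_neg (neg_neg_of_pos hω)).2
        (NNReal.tendsto_coe_atTop.2 tendsto_id)
    have h2 := (tendsto_real_toNNReal h1).const_mul s
    simpa using h2
  · obtain ⟨y, hy, hyD⟩ := inputMap_bound_eOrlicz hM' hΦ hD hu
    refine ⟨T t x₀ + y, by rw [_root_.map_add, hy, mildSolution_eq], ?_⟩
    rw [← NNReal.coe_le_coe]
    push_cast
    rw [Real.coe_toNNReal _ (by positivity), mul_comm ‖x₀‖]
    refine (norm_add_le _ _).trans (add_le_add ((T t).le_of_opNorm_le (hT t) x₀) (hyD.trans ?_))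
    exact mul_le_mul_of_nonneg_left (by simp) (luxemburgNorm Φ t u).2

end Bound

/-! ### The equivalence -/

section Equivalence

variable {T : C0Semigroup 𝕜 X} {β : T.resolventSet} {B : U →L[𝕜] T.Extrapolation β}

theorem mildSolution_zero (x₀ : X) (t : ℝ≥0) :
    T.mildSolution β B x₀ 0 t = T.embed β (T t x₀) := by
  rw [mildSolution_eq, inputMap_zero, add_zero]

theorem mildSolution_zero_left (u : ℝ → U) (t : ℝ≥0) :
    T.mildSolution β B 0 u t = T.inputMap β B t u := by
  rw [mildSolution_eq, _root_.map_zero, _root_.map_zero, zero_add]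

theorem _root_.ClassKInf.comp {θ μ : ℝ≥0 → ℝ≥0} (hθ : ClassKInf θ) (hμ : ClassKInf μ) :
    ClassKInf (θ ∘ μ) where
  zero := by simp [hθ.zero, hμ.zero]
  continuous := hθ.continuous.comp hμ.continuous
  strictMono := hθ.strictMono.comp hμ.strictMono
  tendsto := hθ.tendsto.comp hμ.tendsto

theorem _root_.ClassKL.le_zero_right {b : ℝ≥0 → ℝ≥0 → ℝ≥0} (hb : ClassKL b) (s t : ℝ≥0) :
    b s t ≤ b s 0 := by
  rcases eq_or_ne s 0 with rfl | hs
  · exact ((hb.left t).zero.trans_le (zero_le))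
  · exact (hb.right s (pos_iff_ne_zero.2 hs)).strictAnti.antitone (zero_le)

theorem IsISS.exponentiallyStable {Φ : ℝ≥0 → ℝ≥0} (hΦ : IsYoungFunction Φ)
    (h : T.IsISS β B (EOrlicz U Φ)) : T.ExponentiallyStable := by
  obtain ⟨b, μ, hb, hμ, h⟩ := h
  refine T.exponentiallyStable_of_apply_le hb fun t x => ?_
  obtain ⟨y, hy, hyb⟩ := h t x 0 (MemLp.mem_eOrlicz hΦ MemLp.zero)
  rw [mildSolution_zero] at hy
  rw [← T.embed_injective β hy]
  simpa [EOrlicz, luxemburgNorm_zero hΦ, hμ.zero] using hyb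

theorem IsIISS.exponentiallyStable (h : T.IsIISS β B (LInf U)) : T.ExponentiallyStable := by
  obtain ⟨b, θ, μ, hb, hθ, hμ, h⟩ := h
  refine T.exponentiallyStable_of_apply_le hb fun t x => ?_
  obtain ⟨y, hy, hyb⟩ := h t x 0 MemLp.zero
  have hE : energy μ t (0 : ℝ → U) = 0 := by simp [energy, hμ.zero]
  rw [mildSolution_zero] at hy
  rw [← T.embed_injective β hy]
  simpa [hE, hθ.zero] using hyb

theorem IsISS.isIISS {Φ : ℝ≥0 → ℝ≥0} (hΦ : IsYoungFunction Φ)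
    (h : T.IsISS β B (EOrlicz U Φ)) : T.IsIISS β B (LInf U) := by
  obtain ⟨b, κ, hb, hκ, h⟩ := h
  obtain ⟨θ, μ, hθ, hμ, hlux⟩ := hΦ.exists_luxemburgNorm_le (U := U)
  refine ⟨b, κ ∘ θ, μ, hb, hκ.comp hθ, hμ, fun t x₀ u hu => ?_⟩
  obtain ⟨x, hx, hxb⟩ := h t x₀ u (MemLp.mem_eOrlicz hΦ hu)
  exact ⟨x, hx, fun hE => hxb.trans (add_le_add_right (hκ.strictMono.monotone (hlux t u hE)) _)⟩

theorem IsISS.isUBEBS {Φ : ℝ≥0 → ℝ≥0} (hΦ : IsYoungFunction Φ)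
    (h : T.IsISS β B (EOrlicz U Φ)) : T.IsUBEBS β B (EOrlicz U Φ) := by
  obtain ⟨b, κ, hb, hκ, h⟩ := h
  have hκm := hκ.strictMono.monotone
  have hκ1 : ∀ s, κ 1 ≤ κ (1 + s) := fun s => hκm le_self_add
  have hb0 := hb.left 0
  have hκ0 : 0 < κ 1 := by
    simpa [hκ.zero] using hκ.strictMono one_pos
  have hκs : Tendsto (fun s => κ (1 + s)) atTop atTop :=
    tendsto_atTop_mono (fun _ => hκm le_add_self) hκ.tendsto
  have hκc := hκ.continuous
  -- The summand s makes γ unbounded, which b(·, 0) alone need not be.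
  have hγ : ClassKInf fun s => b s 0 + s :=
    ⟨⟨by simp [hb0.zero], hb0.continuous.add continuous_id, hb0.strictMono.add strictMono_id⟩,
      tendsto_atTop_mono (fun _ => le_add_self) tendsto_id⟩
  -- κ(‖u‖) ≤ κ(1 + E) = (κ(1 + E) − κ(1)) + κ(1): the difference vanishes at E = 0 as class `𝒦_∞`
  -- demands, and κ(1) becomes the constant c.
  have hθ : ClassKInf fun s => κ (1 + s) - κ 1 := by
    refine ⟨⟨by simp, by fun_prop, fun x y hxy => ?_⟩, tendsto_atTop.2 fun a => ?_⟩
    · exact (tsub_lt_tsub_iff_right (hκ1 x)).2 (hκ.strictMono (add_lt_add_right hxy 1))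
    · exact (tendsto_atTop.1 hκs (a + κ 1)).mono fun s hs => le_tsub_of_add_le_right hs
  refine ⟨_, _, Φ, κ 1, hγ, hθ, ⟨hΦ.map_zero, hΦ.continuous, hΦ.strictMono⟩, hκ0,
    fun t x₀ u hu => ?_⟩
  obtain ⟨x, hx, hxb⟩ := h t x₀ u hu
  refine ⟨x, hx, fun hE => hxb.trans ?_⟩
  rw [add_assoc, tsub_add_cancel_of_le (hκ1 _)]
  exact add_le_add ((hb.le_zero_right _ _).trans le_self_add)
    (hκm (luxemburgNorm_le_one_add hΦ hE))

end Equivalence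

end C0Semigroup

end

theorem mainTheorem1 {𝕜 X U : Type*} [RCLike 𝕜]
    [NormedAddCommGroup X] [NormedSpace 𝕜 X] [CompleteSpace X]
    [NormedAddCommGroup U] [NormedSpace 𝕜 U] [CompleteSpace U]
    (T : C0Semigroup 𝕜 X) (β : T.resolventSet) (B : U →L[𝕜] T.Extrapolation β) :
    List.TFAE [
      ∃ Φ : ℝ≥0 → ℝ≥0, IsYoungFunction Φ ∧ T.IsISS β B (EOrlicz U Φ),
      T.IsIISS β B (LInf U),
      T.ExponentiallyStable ∧
        ∃ Φ : ℝ≥0 → ℝ≥0, IsYoungFunction Φ ∧ T.IsUBEBS β B (EOrlicz U Φ)] := by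
  tfae_have 1 → 2 := fun ⟨_, hΦ, h⟩ => h.isIISS hΦ
  tfae_have 1 → 3 := fun ⟨Φ, hΦ, h⟩ => ⟨h.exponentiallyStable hΦ, Φ, hΦ, h.isUBEBS hΦ⟩
  tfae_have 2 → 1 := fun h => by
    have hstab := h.exponentiallyStable
    obtain ⟨b, θ, μ, hb, hθ, hμ, h⟩ := h
    refine hstab.exists_isISS_eOrlicz (c := 0) hθ.strictMono.monotone hμ fun t u hu => ?_
    obtain ⟨x, hx, hxb⟩ := h t 0 u hu
    rw [C0Semigroup.mildSolution_zero_left] at hx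
    simp only [nnnorm_zero, (hb.left t).zero, zero_add] at hxb
    exact ⟨x, hx, by simpa using hxb⟩
  -- The estimate is used only for x₀ = 0 and bounded inputs; the Young function of (i) is built
  -- anew from μ.
  tfae_have 3 → 1 := fun ⟨hstab, Φ, hΦ, γ, θ, μ, c, hγ, hθ, hμ, _, h⟩ => by
    refine hstab.exists_isISS_eOrlicz (c := c) hθ.strictMono.monotone hμ fun t u hu => ?_
    obtain ⟨x, hx, hxb⟩ := h t 0 u (MemLp.mem_eOrlicz hΦ hu)
    rw [C0Semigroup.mildSolution_zero_left] at hx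
    simp only [nnnorm_zero, hγ.zero, zero_add] at hxb
    exact ⟨x, hx, hxb⟩
  tfae_finish
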